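/- Let $G$ be a group generated by a finite set $S$, with the word metric $\mathrm{dist}(g,h)=|g^{-1}h|_S$. Suppose that all asymptotic cones $\mathrm{Con}^\omega(G,(d_i))$ of $G$ are simply connected, where $\omega$ runs over all non-principal ultrafilters on $\mathbb N$ and $(d_i)$ over all non-decreasing sequences of positive real numbers with $d_i\to\infty$. (The cone is the set of sequences $(g_i)$ in $G$ with $\lim^\omega \mathrm{dist}(g_i,1)/d_i<\infty$, with the distance $\lim^\omega \mathrm{dist}(g_i,h_i)/d_i$, modulo identifying sequences at distance $0$.) Then $G$ is finitely presented, and for every finite presentation $\langle X\mid R\rangle$ of $G$: 1. $G$ has a polynomial isoperimetric function: the Dehn function $f$ of $\langle X\mid R\rangle$ satisfies $f\prec p$ for some polynomial $p$, where $f(n)$ is the least number such that every word of length at most $n$ that equals $1$ in $G$ is the boundary label of a van Kampen diagram over $\langle X\mid R\rangle$ with at most $f(n)$ cells; 2. $G$ has a linear isodiametric function: $\mathrm{di}(n)\prec n$, where $\mathrm{di}(n)$ is the maximum, over all words $w$ of length at most $n$ that equal $1$ in $G$, of the minimal diameter (of the underlying graph) of a van Kampen diagram over $\langle X\mid R\rangle$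 with boundary label $w$. Here $f\prec g$ means that for some constant $C$ one has $f(n)\le C\,g(Cn)+Cn+C$ for all $n\in\mathbb N$. -/

import Mathlib

open Filter Topology

/-! ## The word metric of a finitely generated group -/

/-- The word length of `g` with respect to `S`: the least length of a product of elements of `S`
and their inverses that equals `g`. -/
noncomputable def wordLength {G : Type*} [Group G] (S : Finset G) (g : G) : ℕ :=
  sInf {n | ∃ l : List G, (∀ x ∈ l, x ∈ S ∨ x⁻¹ ∈ S) ∧ l.prod = g ∧ l.length = n}

section WordLength

variable {G : Type*} [Group G] {S : Finset G}

theorem exists_word_of_closure (hS : Subgroup.closure (S : Set G) = ⊤) (g : G) :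
    ∃ l : List G, (∀ x ∈ l, x ∈ S ∨ x⁻¹ ∈ S) ∧ l.prod = g ∧ l.length = wordLength S g := by
  have hne : {n | ∃ l : List G, (∀ x ∈ l, x ∈ S ∨ x⁻¹ ∈ S) ∧ l.prod = g ∧
      l.length = n}.Nonempty := by
    have hg : g ∈ (Subgroup.closure (S : Set G)).toSubmonoid := hS ▸ Subgroup.mem_top g
    rw [Subgroup.closure_toSubmonoid] at hg
    obtain ⟨l, hl, hp⟩ := Submonoid.exists_list_of_mem_closure hg
    exact ⟨l.length, l, by simpa using hl, hp, rfl⟩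
  exact Nat.sInf_mem hne

theorem wordLength_le (l : List G) (hl : ∀ x ∈ l, x ∈ S ∨ x⁻¹ ∈ S) :
    wordLength S l.prod ≤ l.length :=
  Nat.sInf_le ⟨l, hl, rfl, rfl⟩

theorem wordLength_one : wordLength S (1 : G) = 0 := by
  simpa using wordLength_le (S := S) ([] : List G) (by simp)

theorem wordLength_mul_le (hS : Subgroup.closure (S : Set G) = ⊤) (g h : G) :
    wordLength S (g * h) ≤ wordLength S g + wordLength S h := by
  obtain ⟨l, hl, rfl, hn⟩ := exists_word_of_closure hS g
  obtain ⟨m, hm, rfl, hk⟩ := exists_word_of_closure hS h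
  rw [← hn, ← hk, ← List.length_append, ← List.prod_append]
  refine wordLength_le _ fun x hx => ?_
  rcases List.mem_append.1 hx with hx | hx
  exacts [hl x hx, hm x hx]

theorem wordLength_inv_le (hS : Subgroup.closure (S : Set G) = ⊤) (g : G) :
    wordLength S g⁻¹ ≤ wordLength S g := by
  obtain ⟨l, hl, rfl, hn⟩ := exists_word_of_closure hS g
  rw [List.prod_inv_reverse]
  refine (wordLength_le _ fun x hx => ?_).trans (by simp [← hn])
  simp only [List.mem_reverse, List.mem_map] at hx
  obtain ⟨y, hy, rfl⟩ := hx
  simpa [or_comm] using hl y hy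

theorem eq_one_of_wordLength (hS : Subgroup.closure (S : Set G) = ⊤) {g : G}
    (hg : wordLength S g = 0) : g = 1 := by
  obtain ⟨l, -, rfl, hn⟩ := exists_word_of_closure hS g
  rw [hg, List.length_eq_zero_iff] at hn
  simp [hn]

end WordLength

/-- The group `G` regarded as a metric space: the vertex set of its Cayley graph with respect to
the finite generating set `S`, with the graph distance `dist g h = |g⁻¹ h|_S`. -/
def WordMetric {G : Type*} [Group G] (S : Finset G)
    (_hS : Subgroup.closure (S : Set G) = ⊤) : Type _ := G

noncomputable instance {G : Type*} [Group G] (S : Finset G)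
    (hS : Subgroup.closure (S : Set G) = ⊤) : MetricSpace (WordMetric S hS) where
  dist := fun (g h : G) => (wordLength S (g⁻¹ * h) : ℝ)
  dist_self := fun (g : G) => by
    simp [wordLength_one]
  dist_comm := fun (g h : G) => by
    have h₁ := wordLength_inv_le hS (g⁻¹ * h)
    have h₂ := wordLength_inv_le hS (h⁻¹ * g)
    simp only [mul_inv_rev, inv_inv] at h₁ h₂
    exact_mod_cast le_antisymm h₂ h₁
  dist_triangle := fun (g h k : G) => by
    have := wordLength_mul_le hS (g⁻¹ * h) (h⁻¹ * k)
    simp only [mul_assoc, mul_inv_cancel_left] at this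
    exact_mod_cast this
  eq_of_dist_eq_zero := fun {g h : G} hgh => by
    have h' : wordLength S (g⁻¹ * h) = 0 := by
      have : ((wordLength S (g⁻¹ * h) : ℕ) : ℝ) = 0 := hgh
      exact_mod_cast this
    exact (inv_mul_eq_one (G := G)).1 (eq_one_of_wordLength hS h')

/-- The identity element of `G`, as a point of the metric space `WordMetric S hS`. -/
def WordMetric.basepoint {G : Type*} [Group G] (S : Finset G)
    (hS : Subgroup.closure (S : Set G) = ⊤) : WordMetric S hS := (1 : G)

/-! ## Asymptotic cones -/

/-- Scaling constants: a non-decreasing sequence of positive reals tending to infinity. -/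
structure ScalingConstants where
  val : ℕ → ℝ
  pos : ∀ i, 0 < val i
  mono : Monotone val
  tendsto : Tendsto val atTop atTop

/-- The sequences `(x i)` in `X` at finite distance from the observation point `(o i)`, i.e. such
that `dist (x i) (o i) / d i` is bounded for `ω`-almost all `i`. -/
def BoundedSeq (X : Type*) [PseudoMetricSpace X] (ω : Ultrafilter ℕ) (d : ScalingConstants)
    (o : ℕ → X) : Type _ :=
  {x : ℕ → X // ∃ C : ℝ, ∀ᶠ i in (ω : Filter ℕ), dist (x i) (o i) / d.val i ≤ C}

section Cone

variable {X : Type*} [PseudoMetricSpace X] {ω : Ultrafilter ℕ} {d : ScalingConstants} {o : ℕ → X}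

/-- The `ω`-limit of the rescaled distances `dist (x i) (y i) / d i`. -/
noncomputable def BoundedSeq.limDist (x y : BoundedSeq X ω d o) : ℝ :=
  limUnder (ω : Filter ℕ) fun i => dist (x.1 i) (y.1 i) / d.val i

theorem BoundedSeq.tendsto_limDist (x y : BoundedSeq X ω d o) :
    Tendsto (fun i => dist (x.1 i) (y.1 i) / d.val i) (ω : Filter ℕ) (𝓝 (x.limDist y)) := by
  obtain ⟨C, hC⟩ := x.2
  obtain ⟨C', hC'⟩ := y.2
  have hmem : ∀ᶠ i in (ω : Filter ℕ),
      dist (x.1 i) (y.1 i) / d.val i ∈ Set.Icc (0 : ℝ) (C + C') := by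
    filter_upwards [hC, hC'] with i h h'
    refine ⟨div_nonneg dist_nonneg (d.pos i).le, ?_⟩
    refine le_trans ?_ (add_le_add h h')
    rw [← add_div]
    exact div_le_div_of_nonneg_right (dist_triangle_right _ _ _) (d.pos i).le
  obtain ⟨a, -, ha⟩ := isCompact_Icc.ultrafilter_le_nhds
    (ω.map fun i => dist (x.1 i) (y.1 i) / d.val i) (le_principal_iff.2 hmem)
  exact tendsto_nhds_limUnder ⟨a, ha⟩

noncomputable instance : PseudoMetricSpace (BoundedSeq X ω d o) where
  dist := BoundedSeq.limDist
  dist_self x := tendsto_nhds_unique (x.tendsto_limDist x) (by simp)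
  dist_comm x y := tendsto_nhds_unique (x.tendsto_limDist y)
    (by simpa only [dist_comm] using y.tendsto_limDist x)
  dist_triangle x y z := by
    refine le_of_tendsto_of_tendsto' (x.tendsto_limDist z)
      ((x.tendsto_limDist y).add (y.tendsto_limDist z)) fun i => ?_
    rw [← add_div]
    exact div_le_div_of_nonneg_right (dist_triangle _ _ _) (d.pos i).le

end Cone

/-- The asymptotic cone `Con^ω(X, (d i), (o i))`: the bounded sequences modulo the relation of being
at `ω`-limit distance `0`, with the metric induced by the `ω`-limit distance. -/
def AsymptoticCone (X : Type*) [PseudoMetricSpace X] (ω : Ultrafilter ℕ) (d : ScalingConstants)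
    (o : ℕ → X) : Type _ :=
  SeparationQuotient (BoundedSeq X ω d o)

noncomputable instance (X : Type*) [PseudoMetricSpace X] (ω : Ultrafilter ℕ) (d : ScalingConstants)
    (o : ℕ → X) : MetricSpace (AsymptoticCone X ω d o) :=
  inferInstanceAs (MetricSpace (SeparationQuotient (BoundedSeq X ω d o)))

/-- Every asymptotic cone of `G` (with the word metric of `S`, observed at the identity) with
respect to a non-principal ultrafilter and a sequence of scaling constants is simply connected. -/
def AllConesSimplyConnected {G : Type*} [Group G] (S : Finset G)
    (hS : Subgroup.closure (S : Set G) = ⊤) : Prop :=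
  ∀ ω : Ultrafilter ℕ, (ω : Filter ℕ) ≤ cofinite → ∀ d : ScalingConstants,
    SimplyConnectedSpace (AsymptoticCone (WordMetric S hS) ω d (fun _ => WordMetric.basepoint S hS))

/-! ## Van Kampen diagrams -/

/-- A van Kampen diagram with boundary label `w` over the presentation with set of relators `R`:
a finite connected graph drawn in the plane, given by its rotation system, with edges labelled by
generators, bounded faces ("cells") labelled by words from `R^{±1}`, and unbounded face labelled
by `w`. Every edge is a pair of opposite darts `a`, `rev a`; each dart has one face on its left,
whose contour continues with `next a`. Since `R^{±1}` is closed under inverses, it does not matter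
in which of the two senses the contours of the cells and of the diagram are read. -/
structure VanKampenDiagram {X : Type*} (R : Set (FreeGroup X)) (w : List (X × Bool)) where
  /-- vertices -/
  V : Type
  /-- darts (oriented edges) -/
  D : Type
  /-- faces, including the unbounded one -/
  F : Type
  [fintypeV : Fintype V]
  [fintypeD : Fintype D]
  [fintypeF : Fintype F]
  /-- the opposite dart -/
  rev : Equiv.Perm D
  rev_rev : ∀ a, rev (rev a) = a
  rev_ne : ∀ a, rev a ≠ a
  /-- the next dart on the contour of the face on the left -/
  next : Equiv.Perm D
  /-- the initial vertex of a dart -/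
  src : D → V
  /-- the face on the left of a dart -/
  face : D → F
  /-- `next ∘ rev` rotates the darts around their common initial vertex -/
  src_eq_iff : ∀ a b, src a = src b ↔ (next * rev).SameCycle a b
  face_eq_iff : ∀ a b, face a = face b ↔ next.SameCycle a b
  /-- the graph is connected -/
  connected : (SimpleGraph.fromRel fun u v => ∃ a, src a = u ∧ src (rev a) = v).Connected
  /-- planarity: Euler's formula `|V| - |E| + |F| = 2`, where `2 |E| = |D|` -/
  euler : 2 * (Fintype.card V + Fintype.card F) = Fintype.card D + 4
  /-- the label of a dart; `(x, true)` is the letter `x` and `(x, false)` the letter `x⁻¹` -/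
  label : D → X × Bool
  label_rev : ∀ a, label (rev a) = ((label a).1, !(label a).2)
  /-- the unbounded face -/
  outer : F
  /-- the contour of every cell, read from a suitable dart, is a word from `R^{±1}` -/
  cell_label : ∀ f, f ≠ outer → ∃ a, face a = f ∧ ∃ r : List (X × Bool),
    r = (List.range (Function.minimalPeriod next a)).map (fun i => label (next^[i] a)) ∧
    FreeGroup.IsReduced r ∧ (FreeGroup.mk r ∈ R ∨ (FreeGroup.mk r)⁻¹ ∈ R)
  /-- the contour of the unbounded face reads `w`; it is empty if the diagram is a point -/
  boundary_label : (IsEmpty D ∧ w = []) ∨ ∃ a, face a = outer ∧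
    w = (List.range (Function.minimalPeriod next a)).map (fun i => label (next^[i] a))

namespace VanKampenDiagram

variable {X : Type*} {R : Set (FreeGroup X)} {w : List (X × Bool)}

/-- The underlying graph of a diagram. -/
def graph (Δ : VanKampenDiagram R w) : SimpleGraph Δ.V :=
  SimpleGraph.fromRel fun u v => ∃ a, Δ.src a = u ∧ Δ.src (Δ.rev a) = v

/-- The number of cells, i.e. of bounded faces. -/
noncomputable def area (Δ : VanKampenDiagram R w) : ℕ := Nat.card {f : Δ.F // f ≠ Δ.outer}

/-- The diameter of the underlying graph. -/
noncomputable def diameter (Δ : VanKampenDiagram R w) : ℕ∞ := Δ.graph.ediam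

end VanKampenDiagram

/-! ## Isoperimetric and isodiametric functions -/

/-- The Dehn function of the presentation `⟨X ∣ R⟩`: the least `N` such that every word of length at
most `n` that is trivial in the group bounds a van Kampen diagram with at most `N` cells
(`⊤` if there is no such `N`). -/
noncomputable def dehnFunction {X : Type*} (R : Set (FreeGroup X)) (n : ℕ) : ℕ∞ :=
  ⨆ (w : List (X × Bool)) (_ : w.length ≤ n)
    (_ : FreeGroup.mk w ∈ Subgroup.normalClosure R),
    ⨅ Δ : VanKampenDiagram R w, (Δ.area : ℕ∞)

/-- The isodiametric function of `⟨X ∣ R⟩`: the maximum, over words of length at most `n` that are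
trivial in the group, of the minimal diameter of a van Kampen diagram with that boundary label. -/
noncomputable def diameterFunction {X : Type*} (R : Set (FreeGroup X)) (n : ℕ) : ℕ∞ :=
  ⨆ (w : List (X × Bool)) (_ : w.length ≤ n)
    (_ : FreeGroup.mk w ∈ Subgroup.normalClosure R),
    ⨅ Δ : VanKampenDiagram R w, Δ.diameter

/-- The relation `f ≺ g`: for some constant `C`, `f n ≤ C g(C n) + C n + C` for all `n`. -/
def Precedes (f : ℕ → ℕ∞) (g : ℕ → ℕ) : Prop :=
  ∃ C : ℕ, ∀ n : ℕ, f n ≤ ((C * g (C * n) + C * n + C : ℕ) : ℕ∞)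

/-- `g` is an isoperimetric function of the presentation `⟨X ∣ R⟩`. -/
def IsIsoperimetricFunction {X : Type*} (R : Set (FreeGroup X)) (g : ℕ → ℕ) : Prop :=
  Precedes (dehnFunction R) g

/-- `g` bounds the isodiametric function of the presentation `⟨X ∣ R⟩` in the sense of `≺`. -/
def IsIsodiametricFunction {X : Type*} (R : Set (FreeGroup X)) (g : ℕ → ℕ) : Prop :=
  Precedes (diameterFunction R) g

/-!
If a loop in a cone is null-homotopic, the homotopy cuts it into a `k × k` grid with small meshes.
Lifting to `G`, and arguing by contradiction with a cone scaled by the lengths of a sequence of bad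
words, one finds bounds such that every long word trivial in `G` is a product of boundedly many
conjugates of trivial words of at most half its length, the conjugators having linear length.
Iterating `log₂ n` times multiplies these bounded numbers to a polynomial in `n`, while the lengths
of the conjugators add up to a geometric series. So the words below a fixed length are a finite set
of relators, and over every finite presentation a trivial word of length `n` is a product of
polynomially many conjugates of relators by elements of length `O(n)`. Van Kampen's lemma turns
such a product into a diagram, where the length of the conjugators bounds the diameter.

For that lemma, a planar map is given by its face contours and built from a point by attaching
edges to the outer contour, closing up parts of it to cells, and folding consecutive inverse
edges. What these moves preserve is that every cocycle is the coboundary of a potential. This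
yields Euler's formula by counting dimensions, while a bound for the potentials of cocycles at
most `1` is preserved as well and bounds distances from the base point. Folding may split off
spheres, which only leaves the component of the outer contour to be considered.
-/

/-! ## Planar maps given by contours -/

/-- The inverse of a letter. -/
def letterInv {X : Type*} (x : X × Bool) : X × Bool := (x.1, !x.2)

@[simp]
theorem letterInv_letterInv {X : Type*} (x : X × Bool) : letterInv (letterInv x) = x := by
  simp [letterInv]

/-- The values `f` of a potential at the initial points of the darts of the path `l` are obtained
from the value `p` at the initial point of `l` by adding up the increments `c`. -/
def IsPotentialAlong {D : Type*} (f c : D → ℝ) : ℝ → List D → Prop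
  | _, [] => True
  | p, y :: l => f y = p ∧ IsPotentialAlong f c (p + c y) l

section IsPotentialAlong

variable {D E : Type*} {f f' c c' : D → ℝ}

theorem isPotentialAlong_append {l m : List D} {p : ℝ} :
    IsPotentialAlong f c p (l ++ m) ↔
      IsPotentialAlong f c p l ∧ IsPotentialAlong f c (p + (l.map c).sum) m := by
  induction l generalizing p with
  | nil => simp [IsPotentialAlong]
  | cons y l ih => simp [IsPotentialAlong, ih, and_assoc, add_assoc]

theorem isPotentialAlong_map {g : E → D} {l : List E} {p : ℝ} :
    IsPotentialAlong f c p (l.map g) ↔ IsPotentialAlong (f ∘ g) (c ∘ g) p l := by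
  induction l generalizing p with
  | nil => rfl
  | cons y l ih => simp [IsPotentialAlong, ih]

theorem IsPotentialAlong.congr {l : List D} {p : ℝ} (h : IsPotentialAlong f c p l)
    (hf : ∀ y ∈ l, f' y = f y) (hc : ∀ y ∈ l, c' y = c y) : IsPotentialAlong f' c' p l := by
  induction l generalizing p with
  | nil => trivial
  | cons y l ih =>
    simp only [List.forall_mem_cons] at hf hc
    exact ⟨hf.1.trans h.1, hc.1 ▸ ih h.2 hf.2 hc.2⟩

end IsPotentialAlong

/-- A labelled map on a surface, not necessarily connected, given by the contours of its outer face
and of its cells. Its edges are pairs of opposite darts `y`, `rev y`, and every dart of the map lies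
on exactly one contour; elements of `D` on no contour do not belong to the map. The vertices are not
part of the data: they are the classes of initial points of darts glued by the contours. -/
structure ContourMap (X D : Type*) where
  rev : D → D
  label : D → X × Bool
  outer : List D
  cells : List (List D)
  rev_rev : Function.Involutive rev
  rev_ne : ∀ y, rev y ≠ y
  label_rev : ∀ y, label (rev y) = letterInv (label y)
  nodup : (outer ++ cells.flatten).Nodup
  rev_mem : ∀ y ∈ outer ++ cells.flatten, rev y ∈ outer ++ cells.flatten

namespace ContourMap

variable {X D : Type*} (M : ContourMap X D)

/-- The darts that belong to the map. -/
def darts : List D := M.outer ++ M.cells.flatten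

theorem nodup_darts : M.darts.Nodup := M.nodup

theorem rev_mem_darts {y : D} (hy : y ∈ M.darts) : M.rev y ∈ M.darts := M.rev_mem y hy

/-- A cocycle: an antisymmetric function on darts with vanishing sum along every contour. -/
structure IsCocycle (c : D → ℝ) : Prop where
  antisymm : ∀ y, c (M.rev y) = -c y
  sum_outer : (M.outer.map c).sum = 0
  sum_cell : ∀ l ∈ M.cells, (l.map c).sum = 0

/-- `c` is the coboundary of the function on vertices whose value at the initial point of the dart
`y` is `f y`; the value at the initial point of the outer contour is `p`. -/
structure IsPotential (c f : D → ℝ) (p : ℝ) : Prop where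
  outer : IsPotentialAlong f c p M.outer
  cell : ∀ l ∈ M.cells, ∃ q, IsPotentialAlong f c q l
  rev : ∀ y ∈ M.darts, f (M.rev y) = f y + c y

/-- Planarity, expressed as vanishing of the first cohomology: every cocycle has a potential.
Moreover the vertices have distance at most `h` from the initial point of the outer contour; this is
tested against `1`-Lipschitz functions. -/
def IsPlanar (h : ℕ) : Prop :=
  ∀ c, M.IsCocycle c → ∃ f p, M.IsPotential c f p ∧
    ((∀ y, c y ≤ 1) → ∀ y ∈ M.darts, f y ≤ p + h)

variable {M}

theorem IsPlanar.mono {h h' : ℕ} (H : M.IsPlanar h) (hh : h ≤ h') : M.IsPlanar h' := by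
  intro c hc
  obtain ⟨f, p, hf, hle⟩ := H c hc
  refine ⟨f, p, hf, fun hc₁ y hy => (hle hc₁ y hy).trans ?_⟩
  gcongr

variable (X) in
/-- The map with one vertex and no edges. -/
def point : ContourMap X Empty where
  rev := id
  label := Empty.elim
  outer := []
  cells := []
  rev_rev := fun _ => rfl
  rev_ne := nofun
  label_rev := nofun
  nodup := by simp
  rev_mem := by simp

theorem isPlanar_point (h : ℕ) : (point X).IsPlanar h :=
  fun _ _ => ⟨0, 0, ⟨trivial, nofun, nofun⟩, nofun⟩

section AttachEdge

variable {u v : List D}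

theorem attachEdge_perm (hM : M.outer = u ++ v) :
    ((u.map Sum.inl ++ Sum.inr true :: Sum.inr false :: v.map Sum.inl) ++
      (M.cells.map (List.map Sum.inl)).flatten).Perm
    ((Sum.inr true : D ⊕ Bool) :: Sum.inr false :: M.darts.map Sum.inl) := by
  rw [darts, hM, ← List.map_flatten, List.map_append, List.map_append, ← List.cons_append,
    ← List.cons_append]
  exact (List.perm_middle.trans (List.perm_middle.cons _)).append_right _

variable (M) in
/-- Attaching a pendant edge with label `x` to the outer contour, between `u` and `v`. -/
def attachEdge (x : X × Bool) (hM : M.outer = u ++ v) :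
    ContourMap X (D ⊕ Bool) where
  rev := Sum.map M.rev not
  label := Sum.elim M.label fun b => cond b x (letterInv x)
  outer := u.map Sum.inl ++ Sum.inr true :: Sum.inr false :: v.map Sum.inl
  cells := M.cells.map (List.map Sum.inl)
  rev_rev := by rintro (y | b) <;> simp [M.rev_rev _]
  rev_ne := by rintro (y | b) <;> simp [M.rev_ne]
  label_rev := by rintro (y | _ | _) <;> simp [M.label_rev]
  nodup := by
    rw [(attachEdge_perm hM).nodup_iff]
    simpa [List.nodup_map_iff Sum.inl_injective] using M.nodup_darts
  rev_mem := by
    simp only [(attachEdge_perm hM).mem_iff]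
    rintro (y | _ | _) hy
    · simpa using M.rev_mem_darts (by simpa using hy)
    all_goals simp

theorem mem_darts_attachEdge {x : X × Bool} {hM : M.outer = u ++ v} {z : D ⊕ Bool} :
    z ∈ (M.attachEdge x hM).darts ↔ z = .inr true ∨ z = .inr false ∨ ∃ y ∈ M.darts, .inl y = z := by
  rw [← List.mem_map, ← List.mem_cons, ← List.mem_cons]
  exact (attachEdge_perm hM).mem_iff

theorem IsPlanar.attachEdge {h : ℕ} (H : M.IsPlanar h) (x : X × Bool) (hM : M.outer = u ++ v)
    (hu : u.length + 1 ≤ h) : (M.attachEdge x hM).IsPlanar h := by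
  intro c hc
  have hc_inr : c (.inr false) = -c (.inr true) := hc.antisymm (.inr true)
  have hc_inl : M.IsCocycle (c ∘ Sum.inl) :=
    ⟨fun y => hc.antisymm (.inl y),
      by simpa [ContourMap.attachEdge, hM, hc_inr, Function.comp_def] using hc.sum_outer,
      by simpa [ContourMap.attachEdge, Function.comp_def] using hc.sum_cell⟩
  obtain ⟨f, p, hf, hle⟩ := H _ hc_inl
  obtain ⟨hfu, hfv⟩ := isPotentialAlong_append.1 (hM ▸ hf.outer)
  set r : ℝ := p + (u.map (c ∘ Sum.inl)).sum with hr
  refine ⟨Sum.elim f fun b => cond b r (r + c (.inr true)), p, ⟨?_, ?_, ?_⟩, ?_⟩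
  · refine isPotentialAlong_append.2 ⟨isPotentialAlong_map.2 hfu, ?_⟩
    simpa [IsPotentialAlong, isPotentialAlong_map, hc_inr, ← hr] using hfv
  · simpa [ContourMap.attachEdge, isPotentialAlong_map] using hf.cell
  · intro z hz
    obtain rfl | rfl | ⟨y, hy, rfl⟩ := mem_darts_attachEdge.1 hz
    exacts [by simp [ContourMap.attachEdge], by simp [ContourMap.attachEdge, hc_inr], hf.rev y hy]
  · intro hc₁ z hz
    have hru : r ≤ p + u.length := by
      have := List.sum_le_card_nsmul (u.map (c ∘ Sum.inl)) 1 (by simp [hc₁])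
      simpa [hr] using this
    have hu' : (u.length : ℝ) + 1 ≤ h := mod_cast hu
    have hc_true := hc₁ (.inr true)
    obtain rfl | rfl | ⟨y, hy, rfl⟩ := mem_darts_attachEdge.1 hz
    · simp only [Sum.elim_inr, cond_true]
      linarith
    · simp only [Sum.elim_inr, cond_false]
      linarith
    · exact hle (fun y => hc₁ _) y hy

end AttachEdge

section Pinch

variable {u r v : List D}

theorem pinch_perm (hM : M.outer = u ++ (r ++ v)) :
    ((u ++ v) ++ (r :: M.cells).flatten).Perm M.darts := by
  rw [darts, hM, List.flatten_cons, ← List.append_assoc (u ++ v), List.append_assoc u]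
  exact (List.perm_append_comm.append_left _).append_right _

variable (M) in
/-- Closing up the part `r` of the outer contour to a new cell. -/
def pinch (hM : M.outer = u ++ (r ++ v)) : ContourMap X D where
  __ := M
  outer := u ++ v
  cells := r :: M.cells
  nodup := (pinch_perm hM).nodup_iff.2 M.nodup
  rev_mem := by simpa only [(pinch_perm hM).mem_iff] using fun _ => M.rev_mem_darts

theorem IsPlanar.pinch {h : ℕ} (H : M.IsPlanar h) (hM : M.outer = u ++ (r ++ v)) :
    (M.pinch hM).IsPlanar h := by
  intro c hc
  have hc_cells := List.forall_mem_cons.1 hc.sum_cell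
  have hc_outer : (u.map c).sum + (v.map c).sum = 0 := by
    simpa [ContourMap.pinch] using hc.sum_outer
  obtain ⟨f, p, hf, hle⟩ := H c ⟨hc.antisymm, by simp [hM, hc_cells.1, hc_outer], hc_cells.2⟩
  obtain ⟨hfu, hfrv⟩ := isPotentialAlong_append.1 (hM ▸ hf.outer)
  obtain ⟨hfr, hfv⟩ := isPotentialAlong_append.1 hfrv
  rw [hc_cells.1, add_zero] at hfv
  exact ⟨f, p, ⟨isPotentialAlong_append.2 ⟨hfu, hfv⟩, List.forall_mem_cons.2 ⟨⟨_, hfr⟩, hf.cell⟩,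
    fun y hy => hf.rev y ((pinch_perm hM).mem_iff.1 hy)⟩,
    fun hc₁ y hy => hle hc₁ y ((pinch_perm hM).mem_iff.1 hy)⟩

end Pinch

section Fold

variable {u v : List D} {a b : D}

theorem fold_perm (hM : M.outer = u ++ a :: b :: v) :
    M.darts.Perm (a :: b :: ((u ++ v) ++ M.cells.flatten)) := by
  rw [darts, hM, ← List.cons_append, ← List.cons_append]
  exact (List.perm_middle.trans (List.perm_middle.cons _)).append_right _

theorem mem_darts_iff_fold (hM : M.outer = u ++ a :: b :: v) {y : D} :
    y ∈ (u ++ v) ++ M.cells.flatten ↔ y ∈ M.darts ∧ y ≠ a ∧ y ≠ b := by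
  have hnodup := (fold_perm hM).nodup_iff.1 M.nodup_darts
  rw [(fold_perm hM).mem_iff]
  grind

theorem ne_of_outer_eq (hM : M.outer = u ++ a :: b :: v) : a ≠ b := by
  have hnodup := (fold_perm hM).nodup_iff.1 M.nodup_darts
  grind

variable [DecidableEq D]

variable (M a b) in
/-- Reversal of darts after the dart `b` has been glued to the reverse of `a`: the edges of `a` and
`b` are replaced by an edge `a`, `b`, split off from the map, and an edge consisting of the reverses
of `a` and `b`. -/
def foldRev (y : D) : D := Equiv.swap b (M.rev a) (M.rev (Equiv.swap b (M.rev a) y))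

theorem foldRev_foldRev : Function.Involutive (M.foldRev a b) := by
  intro y
  simp [foldRev, M.rev_rev _]

theorem foldRev_left (hab : a ≠ b) : M.foldRev a b a = b := by
  simp [foldRev, Equiv.swap_apply_of_ne_of_ne hab (M.rev_ne a).symm]

theorem foldRev_right (hab : a ≠ b) : M.foldRev a b b = a := by
  conv_rhs => rw [← foldRev_foldRev (M := M) (a := a) (b := b) a, foldRev_left hab]

theorem foldRev_rev_left (hab : a ≠ b) : M.foldRev a b (M.rev a) = M.rev b := by
  have : M.rev b ≠ M.rev a := fun h => hab (M.rev_rev.injective h.symm)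
  simp [foldRev, Equiv.swap_apply_of_ne_of_ne (M.rev_ne b) this]

theorem foldRev_of_ne {y : D} (ha : y ≠ a) (hb : y ≠ b) (hra : y ≠ M.rev a)
    (hrb : y ≠ M.rev b) : M.foldRev a b y = M.rev y := by
  have h₁ : M.rev y ≠ b := fun h => hrb (by rw [← h, M.rev_rev])
  have h₂ : M.rev y ≠ M.rev a := fun h => ha (M.rev_rev.injective h)
  rw [foldRev, Equiv.swap_apply_of_ne_of_ne hb hra, Equiv.swap_apply_of_ne_of_ne h₁ h₂]

theorem label_swap {a b : D} (hlabel : M.label b = letterInv (M.label a)) (y : D) :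
    M.label (Equiv.swap b (M.rev a) y) = M.label y := by
  have := M.label_rev a
  grind

theorem swap_mem_darts {a b : D} (ha : a ∈ M.darts) (hb : b ∈ M.darts) {y : D} (hy : y ∈ M.darts) :
    Equiv.swap b (M.rev a) y ∈ M.darts := by
  have := M.rev_mem_darts ha
  grind

variable (M) in
/-- Folding together two consecutive darts `a`, `b` of the outer contour with inverse labels. -/
def fold (hM : M.outer = u ++ a :: b :: v) (hlabel : M.label b = letterInv (M.label a)) :
    ContourMap X D where
  rev := M.foldRev a b
  label := M.label
  outer := u ++ v
  cells := M.cells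
  rev_rev := foldRev_foldRev
  rev_ne y := by
    rw [foldRev, Ne, ← Equiv.eq_symm_apply, Equiv.symm_swap]
    exact M.rev_ne _
  label_rev y := by rw [foldRev, label_swap hlabel, M.label_rev, label_swap hlabel]
  nodup := ((fold_perm hM).nodup_iff.1 M.nodup_darts).of_cons.of_cons
  rev_mem y hy := by
    have hab := ne_of_outer_eq hM
    have ha : a ∈ M.darts := (fold_perm hM).mem_iff.2 (by simp)
    have hb : b ∈ M.darts := (fold_perm hM).mem_iff.2 (by simp)
    obtain ⟨hy, hya, hyb⟩ := (mem_darts_iff_fold hM).1 hy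
    refine (mem_darts_iff_fold hM).2 ⟨swap_mem_darts ha hb (M.rev_mem_darts
      (swap_mem_darts ha hb hy)), fun h => hyb ?_, fun h => hya ?_⟩
    · exact foldRev_foldRev.injective (h.trans (foldRev_right hab).symm)
    · exact foldRev_foldRev.injective (h.trans (foldRev_left hab).symm)

variable (M a b) in
/-- The folding map on darts, which carries the edges of `a` and `b` to the edge glued from them. -/
def foldMap : D → D := Function.update (Function.update id b (M.rev a)) a (M.rev b)

theorem foldMap_left : M.foldMap a b a = M.rev b := by simp [foldMap]

theorem foldMap_right (hab : a ≠ b) : M.foldMap a b b = M.rev a := by simp [foldMap, hab.symm]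

theorem foldMap_of_ne {y : D} (ha : y ≠ a) (hb : y ≠ b) : M.foldMap a b y = y := by
  simp [foldMap, ha, hb]

theorem foldMap_rev_left (hab : a ≠ b) : M.foldMap a b (M.rev a) = M.rev a := by
  by_cases h : M.rev a = b
  · rw [h, foldMap_right hab, h]
  · exact foldMap_of_ne (M.rev_ne a) h

theorem foldMap_rev_right : M.foldMap a b (M.rev b) = M.rev b := by
  by_cases h : M.rev b = a
  · rw [h, foldMap_left, h]
  · exact foldMap_of_ne h (M.rev_ne b)

theorem foldMap_rev (hab : a ≠ b) (y : D) :
    M.foldMap a b (M.rev y) = M.foldRev a b (M.foldMap a b y) := by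
  have hrev_left := foldRev_rev_left hab (M := M)
  have hrev_right : M.foldRev a b (M.rev b) = M.rev a := by rw [← hrev_left, foldRev_foldRev]
  by_cases ha : y = a
  · rw [ha, foldMap_rev_left hab, foldMap_left, hrev_right]
  by_cases hb : y = b
  · rw [hb, foldMap_rev_right, foldMap_right hab, hrev_left]
  rw [foldMap_of_ne ha hb]
  by_cases hra : y = M.rev a
  · rw [hra, M.rev_rev, foldMap_left, hrev_left]
  by_cases hrb : y = M.rev b
  · rw [hrb, M.rev_rev, foldMap_right hab, hrev_right]
  rw [foldRev_of_ne ha hb hra hrb, foldMap_of_ne]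
  · exact fun h => hra (by rw [← h, M.rev_rev])
  · exact fun h => hrb (by rw [← h, M.rev_rev])

theorem foldMap_of_mem (hM : M.outer = u ++ a :: b :: v) {y : D}
    (hy : y ∈ (u ++ v) ++ M.cells.flatten) : M.foldMap a b y = y :=
  foldMap_of_ne ((mem_darts_iff_fold hM).1 hy).2.1 ((mem_darts_iff_fold hM).1 hy).2.2

section Cocycle

variable {hM : M.outer = u ++ a :: b :: v} {hlabel : M.label b = letterInv (M.label a)} {c : D → ℝ}

theorem IsCocycle.apply_rev_right (hc : (M.fold hM hlabel).IsCocycle c) :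
    c (M.rev b) = -c (M.rev a) := by
  rw [← foldRev_rev_left (ne_of_outer_eq hM)]
  exact hc.antisymm _

theorem IsCocycle.comp_foldMap (hc : (M.fold hM hlabel).IsCocycle c) :
    M.IsCocycle (c ∘ M.foldMap a b) := by
  have hab := ne_of_outer_eq hM
  have hmap : ∀ l ⊆ (u ++ v) ++ M.cells.flatten, l.map (c ∘ M.foldMap a b) = l.map c :=
    fun l hl => List.map_congr_left fun y hy => congrArg c (foldMap_of_mem hM (hl hy))
  refine ⟨fun y => ?_, ?_, fun l hl => ?_⟩
  · rw [Function.comp_apply, foldMap_rev hab]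
    exact hc.antisymm _
  · have hsum : (u.map c).sum + (v.map c).sum = 0 := by simpa [fold] using hc.sum_outer
    simp only [hM, List.map_append, List.map_cons, hmap u (by simp), hmap v (by simp),
      List.sum_append, List.sum_cons, Function.comp_apply, foldMap_left, foldMap_right hab,
      hc.apply_rev_right]
    linarith
  · rw [hmap l fun y hy => List.mem_append_right _ (List.mem_flatten_of_mem hl hy)]
    exact hc.sum_cell l hl

theorem IsPotential.of_comp_foldMap {f : D → ℝ} {p : ℝ} (hc : (M.fold hM hlabel).IsCocycle c)
    (hf : M.IsPotential (c ∘ M.foldMap a b) f p) : (M.fold hM hlabel).IsPotential c f p := by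
  have hab := ne_of_outer_eq hM
  have hcongr : ∀ y ∈ (u ++ v) ++ M.cells.flatten, c y = (c ∘ M.foldMap a b) y :=
    fun y hy => congrArg c (foldMap_of_mem hM hy).symm
  have hrev : c (M.rev b) + c (M.rev a) = 0 := by simp [hc.apply_rev_right]
  obtain ⟨hfu, hfa, hfb, hfv⟩ := isPotentialAlong_append.1 (hM ▸ hf.outer)
  simp only [Function.comp_apply, foldMap_left, foldMap_right hab, add_assoc, hrev,
    add_zero] at hfb hfv
  have hf_rev_a : f (M.rev a) = f b := by
    rw [hf.rev a ((fold_perm hM).mem_iff.2 (by simp)), Function.comp_apply, foldMap_left]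
    linarith
  have hf_rev_b : f (M.rev b) = f a := by
    rw [hf.rev b ((fold_perm hM).mem_iff.2 (by simp)), Function.comp_apply, foldMap_right hab]
    linarith
  refine ⟨isPotentialAlong_append.2 ⟨?_, ?_⟩, fun l hl => ?_, fun y hy => ?_⟩
  · exact hfu.congr (fun _ _ => rfl) fun y hy => hcongr y (by simp [hy])
  · rw [List.map_congr_left fun y (hy : y ∈ u) => hcongr y (by simp [hy])]
    exact hfv.congr (fun _ _ => rfl) fun y hy => hcongr y (by simp [hy])
  · obtain ⟨q, hq⟩ := hf.cell l hl
    exact ⟨q, hq.congr (fun _ _ => rfl) fun y hy =>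
      hcongr y (List.mem_append_right _ (List.mem_flatten_of_mem hl hy))⟩
  · change f (M.foldRev a b y) = f y + c y
    obtain ⟨hy_mem, hya, hyb⟩ := (mem_darts_iff_fold hM).1 hy
    by_cases hra : y = M.rev a
    · rw [hra, foldRev_rev_left hab, hf_rev_a, hf_rev_b]
      linarith
    by_cases hrb : y = M.rev b
    · rw [hrb, ← foldRev_rev_left hab, foldRev_foldRev, foldRev_rev_left hab, hf_rev_a, hf_rev_b]
      linarith
    rw [foldRev_of_ne hya hyb hra hrb, hf.rev y hy_mem, hcongr y hy]

end Cocycle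

theorem IsPlanar.fold {h : ℕ} (H : M.IsPlanar h) (hM : M.outer = u ++ a :: b :: v)
    (hlabel : M.label b = letterInv (M.label a)) : (M.fold hM hlabel).IsPlanar h := by
  intro c hc
  obtain ⟨f, p, hf, hle⟩ := H _ hc.comp_foldMap
  exact ⟨f, p, hf.of_comp_foldMap hc, fun hc₁ y hy =>
    hle (fun y => hc₁ _) y ((mem_darts_iff_fold hM).1 hy).1⟩

end Fold

end ContourMap

/-- The nonempty reduced word `l` represents an element of `R` or the inverse of one. -/
def IsRelatorWord {X : Type*} (R : Set (FreeGroup X)) (l : List (X × Bool)) : Prop :=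
  l ≠ [] ∧ FreeGroup.IsReduced l ∧ (FreeGroup.mk l ∈ R ∨ (FreeGroup.mk l)⁻¹ ∈ R)

/-- The word `w` labels the outer contour of a planar map with at most `A` cells, all labelled by
relators, whose vertices have distance at most `h` from the initial point of the outer contour. -/
def HasPlanarFilling {X : Type*} (R : Set (FreeGroup X)) (w : List (X × Bool)) (A h : ℕ) : Prop :=
  ∃ (D : Type) (M : ContourMap X D), M.outer.map M.label = w ∧
    (∀ l ∈ M.cells, IsRelatorWord R (l.map M.label)) ∧ M.cells.length ≤ A ∧ M.IsPlanar h

namespace HasPlanarFilling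

variable {X : Type*} {R : Set (FreeGroup X)} {A A' h h' : ℕ} {w w' w₁ w₂ r t : List (X × Bool)}

theorem nil : HasPlanarFilling R [] A h :=
  ⟨Empty, .point X, rfl, nofun, Nat.zero_le A, ContourMap.isPlanar_point h⟩

theorem mono (H : HasPlanarFilling R w A h) (hA : A ≤ A') (hh : h ≤ h') :
    HasPlanarFilling R w A' h' := by
  obtain ⟨D, M, hw, hR, hcells, hM⟩ := H
  exact ⟨D, M, hw, hR, hcells.trans hA, hM.mono hh⟩

theorem insert (H : HasPlanarFilling R (w₁ ++ w₂) A h) (x : X × Bool) (hh : w₁.length + 1 ≤ h) :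
    HasPlanarFilling R (w₁ ++ x :: letterInv x :: w₂) A h := by
  obtain ⟨D, M, hw, hR, hcells, hM⟩ := H
  obtain ⟨u, v, huv, rfl, rfl⟩ := List.map_eq_append_iff.1 hw
  refine ⟨_, M.attachEdge x huv, ?_, ?_, by simpa [ContourMap.attachEdge] using hcells,
    hM.attachEdge x huv (by simpa using hh)⟩
  · simp [ContourMap.attachEdge, Function.comp_def]
  · simpa [ContourMap.attachEdge, Function.comp_def] using hR

theorem pinch (H : HasPlanarFilling R (w₁ ++ (r ++ w₂)) A h) (hr : IsRelatorWord R r) :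
    HasPlanarFilling R (w₁ ++ w₂) (A + 1) h := by
  obtain ⟨D, M, hw, hR, hcells, hM⟩ := H
  obtain ⟨u, rv, huv, rfl, hrv⟩ := List.map_eq_append_iff.1 hw
  obtain ⟨r, v, rfl, rfl, rfl⟩ := List.map_eq_append_iff.1 hrv
  exact ⟨D, M.pinch huv, List.map_append, List.forall_mem_cons.2 ⟨hr, hR⟩,
    Nat.succ_le_succ hcells, hM.pinch huv⟩

open Classical in
theorem fold (x : X × Bool) (H : HasPlanarFilling R (w₁ ++ x :: letterInv x :: w₂) A h) :
    HasPlanarFilling R (w₁ ++ w₂) A h := by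
  obtain ⟨D, M, hw, hR, hcells, hM⟩ := H
  obtain ⟨u, abv, huv, rfl, habv⟩ := List.map_eq_append_iff.1 hw
  obtain ⟨a, bv, rfl, rfl, hbv⟩ := List.map_eq_cons_iff.1 habv
  obtain ⟨b, v, rfl, hb, rfl⟩ := List.map_eq_cons_iff.1 hbv
  exact ⟨D, M.fold huv hb, List.map_append, hR, hcells, hM.fold huv hb⟩

theorem insert_invRev (H : HasPlanarFilling R (w₁ ++ w₂) A h) (hh : w₁.length + t.length ≤ h) :
    HasPlanarFilling R (w₁ ++ (t ++ (FreeGroup.invRev t ++ w₂))) A h := by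
  induction t generalizing w₁ w₂ with
  | nil => simpa using H
  | cons x t ih =>
    simp only [List.length_cons] at hh
    have := ih (w₁ := w₁ ++ [x]) (by simpa using H.insert x (by lia)) (by simp; lia)
    simpa [FreeGroup.invRev, letterInv] using this

theorem of_red (H : HasPlanarFilling R w A h) (hw : FreeGroup.Red w w') :
    HasPlanarFilling R w' A h := by
  induction hw with
  | refl => exact H
  | tail _ hstep ih =>
    obtain @⟨u, v, x, b⟩ := hstep
    exact ih.fold (x, b)

theorem of_red' (H : HasPlanarFilling R w' A h) (hw : FreeGroup.Red w w') (hh : w.length ≤ h) :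
    HasPlanarFilling R w A h := by
  induction hw using Relation.ReflTransGen.head_induction_on with
  | refl => exact H
  | head hstep _ ih =>
    obtain @⟨u, v, x, b⟩ := hstep
    simp only [List.length_append, List.length_cons] at hh ih
    exact (ih (by lia)).insert (x, b) (by lia)

theorem of_mk_eq_mk (H : HasPlanarFilling R w' A h) (hw : FreeGroup.mk w' = FreeGroup.mk w)
    (hh : w.length ≤ h) : HasPlanarFilling R w A h := by
  obtain ⟨v, hw', hw⟩ := FreeGroup.Red.exact.1 hw
  exact (H.of_red hw').of_red' hw hh

/-- Attach a path labelled `x` with a loop labelled `t` at its end, and close up the loop. -/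
theorem conj_append [DecidableEq X] {x t : FreeGroup X} (H : HasPlanarFilling R w A h)
    (hxt : x.norm + t.norm ≤ h) (ht : t ∈ R ∨ t⁻¹ ∈ R) (ht_one : t ≠ 1) :
    HasPlanarFilling R (x.toWord ++ t.toWord ++ (FreeGroup.invRev x.toWord ++ w)) (A + 1) h := by
  have hrel : IsRelatorWord R (FreeGroup.invRev t.toWord) := by
    rw [← FreeGroup.toWord_inv]
    refine ⟨by rwa [Ne, FreeGroup.toWord_eq_nil_iff, inv_eq_one], FreeGroup.isReduced_toWord, ?_⟩
    rw [FreeGroup.mk_toWord, inv_inv]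
    exact ht.symm
  have hx : HasPlanarFilling R (x.toWord ++ (FreeGroup.invRev x.toWord ++ w)) A h :=
    insert_invRev (w₁ := []) H (by simpa [FreeGroup.norm] using (Nat.le_add_right _ _).trans hxt)
  have hxt' := hx.insert_invRev (t := t.toWord) hxt
  rw [← List.append_assoc] at hxt'
  exact hxt'.pinch hrel

end HasPlanarFilling

/-! ## Products of conjugates -/

/-- `g` is a product of `A` conjugates `x * t * x⁻¹` of elements `t` of `T ∪ T⁻¹`, with conjugating
elements `x` of length at most `h`. -/
inductive IsConjProd {X : Type*} [DecidableEq X] (T : Set (FreeGroup X)) (h : ℕ) :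
    ℕ → FreeGroup X → Prop
  | one : IsConjProd T h 0 1
  | cons {A : ℕ} {g x t : FreeGroup X} : x.norm ≤ h → (t ∈ T ∨ t⁻¹ ∈ T) → IsConjProd T h A g →
      IsConjProd T h (A + 1) (x * t * x⁻¹ * g)

namespace IsConjProd

variable {X : Type*} [DecidableEq X] {T : Set (FreeGroup X)} {h h' A B : ℕ} {g g' : FreeGroup X}

theorem mono (H : IsConjProd T h A g) (hh : h ≤ h') : IsConjProd T h' A g := by
  induction H with
  | one => exact .one
  | cons hx ht _ ih => exact .cons (hx.trans hh) ht ih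

theorem mul (H : IsConjProd T h A g) (H' : IsConjProd T h B g') :
    IsConjProd T h (A + B) (g * g') := by
  induction H with
  | one => simpa using H'
  | cons hx ht _ ih =>
    rw [mul_assoc, Nat.succ_add]
    exact .cons hx ht ih

theorem conj (x : FreeGroup X) (H : IsConjProd T h A g) :
    IsConjProd T (x.norm + h) A (x * g * x⁻¹) := by
  induction H with
  | one => simpa using .one
  | @cons A g y t hy ht _ ih =>
    have := cons ((FreeGroup.norm_mul_le x y).trans (Nat.add_le_add_left hy _)) ht ih
    convert this using 1
    group

theorem of_mem {t : FreeGroup X} (ht : t ∈ T ∨ t⁻¹ ∈ T) : IsConjProd T h 1 t := by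
  simpa using cons (x := 1) (h := h) (by simp) ht .one

theorem inv (H : IsConjProd T h A g) : IsConjProd T h A g⁻¹ := by
  induction H with
  | one => simpa using .one
  | @cons A g x t hx ht _ ih =>
    have ht' : t⁻¹ ∈ T ∨ t⁻¹⁻¹ ∈ T := by simpa [or_comm] using ht
    simpa [mul_assoc] using ih.mul (cons hx ht' .one)

theorem subst {U : Set (FreeGroup X)} (H : IsConjProd T h A g)
    (hT : ∀ t ∈ T, ∃ B' ≤ B, IsConjProd U h' B' t) :
    ∃ B' ≤ A * B, IsConjProd U (h + h') B' g := by
  induction H with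
  | one => exact ⟨0, by simp, .one⟩
  | @cons A g x t hx ht _ ih =>
    obtain ⟨B₁, hB₁, hg⟩ := ih
    obtain ⟨B₂, hB₂, ht⟩ : ∃ B' ≤ B, IsConjProd U h' B' t := by
      rcases ht with ht | ht
      · exact hT t ht
      · obtain ⟨B', hB', ht⟩ := hT _ ht
        exact ⟨B', hB', by simpa using ht.inv⟩
    exact ⟨B₂ + B₁, by rw [Nat.succ_mul]; lia,
      ((ht.conj x).mono (Nat.add_le_add_right hx _)).mul hg⟩

theorem mem_normalClosure (H : IsConjProd T h A g) : g ∈ Subgroup.normalClosure T := by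
  induction H with
  | one => exact one_mem _
  | @cons _ _ x t _ ht _ ih =>
    refine mul_mem (Subgroup.normalClosure_normal.conj_mem _ ?_ x) ih
    rcases ht with ht | ht
    · exact Subgroup.subset_normalClosure ht
    · exact inv_mem_iff.1 (Subgroup.subset_normalClosure ht)

theorem exists_of_mem_normalClosure (hg : g ∈ Subgroup.normalClosure T) :
    ∃ h A, IsConjProd T h A g := by
  induction hg using Subgroup.closure_induction with
  | mem y hy =>
    obtain ⟨t, ht, hty⟩ := Group.mem_conjugatesOfSet_iff.1 hy
    obtain ⟨x, rfl⟩ := isConj_iff.1 hty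
    exact ⟨_, 1, (of_mem (h := 0) (Or.inl ht)).conj x⟩
  | one => exact ⟨0, 0, .one⟩
  | mul x y _ _ hx hy =>
    obtain ⟨h₁, A₁, H₁⟩ := hx
    obtain ⟨h₂, A₂, H₂⟩ := hy
    exact ⟨max h₁ h₂, A₁ + A₂, (H₁.mono (le_max_left _ _)).mul (H₂.mono (le_max_right _ _))⟩
  | inv x _ hx =>
    obtain ⟨h₁, A₁, H₁⟩ := hx
    exact ⟨h₁, A₁, H₁.inv⟩

theorem exists_hasPlanarFilling {M : ℕ} (hT : ∀ t ∈ T, t.norm ≤ M) (H : IsConjProd T h A g) :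
    ∃ w, FreeGroup.mk w = g ∧ HasPlanarFilling T w A (h + M) := by
  induction H with
  | one => exact ⟨[], rfl, .nil⟩
  | @cons A g x t hx ht _ ih =>
    obtain ⟨w, rfl, hw⟩ := ih
    rcases eq_or_ne t 1 with rfl | ht_one
    · exact ⟨w, by simp, hw.mono (Nat.le_succ A) le_rfl⟩
    have htM : t.norm ≤ M := by
      rcases ht with ht | ht
      exacts [hT t ht, by simpa using hT _ ht]
    refine ⟨_, ?_, hw.conj_append (Nat.add_le_add hx htM) ht ht_one⟩
    simp only [← FreeGroup.mul_mk, ← FreeGroup.inv_mk, FreeGroup.mk_toWord, mul_assoc]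

theorem hasPlanarFilling {w : List (X × Bool)} {M : ℕ} (hT : ∀ t ∈ T, t.norm ≤ M)
    (H : IsConjProd T h A (FreeGroup.mk w)) : HasPlanarFilling T w A (max (h + M) w.length) := by
  obtain ⟨w', hw', hfill⟩ := H.exists_hasPlanarFilling hT
  exact (hfill.mono le_rfl (le_max_left _ _)).of_mk_eq_mk hw' (le_max_right _ _)

end IsConjProd

/-! ## Rotation systems -/

section FormPerm

variable {α : Type*} [DecidableEq α] {L : List (List α)} {y : α}

theorem prod_map_formPerm_apply_of_notMem (hy : y ∉ L.flatten) :
    (L.map List.formPerm).prod y = y := by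
  induction L with
  | nil => simp
  | cons m L ih =>
    simp only [List.flatten_cons, List.mem_append, not_or] at hy
    rw [List.map_cons, List.prod_cons, Equiv.Perm.mul_apply, ih hy.2,
      List.formPerm_apply_of_notMem hy.1]

theorem prod_map_formPerm_apply (hL : L.flatten.Nodup) {l : List α} (hl : l ∈ L) (hy : y ∈ l) :
    (L.map List.formPerm).prod y = l.formPerm y := by
  induction L with
  | nil => simp at hl
  | cons m L ih =>
    obtain ⟨-, hL', hdisj⟩ := List.nodup_append'.1 hL
    rw [List.map_cons, List.prod_cons, Equiv.Perm.mul_apply]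
    rcases List.mem_cons.1 hl with rfl | hl
    · rw [prod_map_formPerm_apply_of_notMem fun h => hdisj hy h]
    · rw [ih hL' hl]
      refine List.formPerm_apply_of_notMem fun h => hdisj h (List.mem_flatten_of_mem hl ?_)
      exact List.formPerm_mem_iff_mem.2 hy

end FormPerm

theorem IsPotentialAlong.apply_getElem {D : Type*} {f c : D → ℝ} {l : List D} {p : ℝ}
    (h : IsPotentialAlong f c p l) (i : ℕ) (hi : i < l.length) :
    f l[i] = p + ((l.take i).map c).sum := by
  induction l generalizing p i with
  | nil => simp at hi
  | cons y l ih =>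
    cases i with
    | zero => simpa using h.1
    | succ i => simpa [add_assoc] using ih h.2 i (by simpa using hi)

theorem IsPotentialAlong.apply_formPerm {D : Type*} [DecidableEq D] {f c : D → ℝ} {l : List D}
    {p : ℝ} (h : IsPotentialAlong f c p l) (hl : l.Nodup) (hsum : (l.map c).sum = 0) {y : D}
    (hy : y ∈ l) : f (l.formPerm y) = f y + c y := by
  obtain ⟨i, hi, rfl⟩ := List.getElem_of_mem hy
  have hstep : f l[i] + c l[i] = p + ((l.take (i + 1)).map c).sum := by
    rw [h.apply_getElem i hi, List.map_take, List.map_take,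
      List.sum_take_succ _ i (by simpa using hi), List.getElem_map, add_assoc]
  rw [hstep, List.formPerm_apply_getElem _ hl, h.apply_getElem]
  rcases Nat.lt_or_ge (i + 1) l.length with hlt | hge
  · rw [Nat.mod_eq_of_lt hlt]
  · rw [le_antisymm hi hge, Nat.mod_self, List.take_length, hsum]
    simp

/-- The label of the contour of a face, read from the dart `a`. -/
noncomputable def contourLabel {D L : Type*} (next : D → D) (label : D → L) (a : D) : List L :=
  (List.range (Function.minimalPeriod next a)).map fun i => label (next^[i] a)

theorem contourLabel_eq_map {D E L : Type*} {next : D → D} {a : D} {g : D → E} {label : E → L}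
    (hg : Function.Injective g) {l : List E} (hl : l.Nodup) (hpos : 0 < l.length)
    (h : ∀ k, g (next^[k] a) = l[k % l.length]'(Nat.mod_lt _ hpos)) :
    contourLabel next (label ∘ g) a = l.map label := by
  have hperiodic : Function.IsPeriodicPt next l.length a := hg <| by
    rw [h, ← Function.iterate_zero_apply next a, h]
    simp
  have hperiod : Function.minimalPeriod next a = l.length := by
    refine le_antisymm (hperiodic.minimalPeriod_le hpos) (not_lt.1 fun hlt => ?_)
    have hreturn : g (next^[0] a) = g (next^[Function.minimalPeriod next a] a) := by simp
    have hmin := (h _).symm.trans (hreturn.symm.trans (h 0))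
    rw [hl.getElem_inj_iff, Nat.mod_eq_of_lt hlt, Nat.zero_mod] at hmin
    exact (hperiodic.minimalPeriod_pos hpos).ne' hmin
  refine List.ext_getElem (by simp [contourLabel, hperiod]) fun i _ hi => ?_
  simp [contourLabel, h, Nat.mod_eq_of_lt (show i < l.length by simpa using hi)]

/-- The dart is obtained from `root` by repeatedly applying `rev` and `next`. -/
inductive IsReachable {D : Type*} (rev next : D → D) (root : D) : D → Prop
  | root : IsReachable rev next root root
  | rev {y : D} : IsReachable rev next root y → IsReachable rev next root (rev y)
  | next {y : D} : IsReachable rev next root y → IsReachable rev next root (next y)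

theorem IsReachable.iterate_next {D : Type*} {rev next : D → D} {root y : D}
    (hy : IsReachable rev next root y) (k : ℕ) : IsReachable rev next root (next^[k] y) := by
  induction k with
  | zero => exact hy
  | succ k ih =>
    rw [Function.iterate_succ_apply']
    exact ih.next

/-- A connected labelled map on a closed oriented surface, with the conventions of
`VanKampenDiagram`. The face of the dart `root` is the outer one. -/
structure RotationSystem (X D : Type*) where
  rev : Equiv.Perm D
  next : Equiv.Perm D
  label : D → X × Bool
  root : D
  rev_rev : ∀ y, rev (rev y) = y
  rev_ne : ∀ y, rev y ≠ y
  label_rev : ∀ y, label (rev y) = letterInv (label y)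
  isReachable : ∀ y, IsReachable rev next root y

namespace RotationSystem

variable {X D : Type*} (N : RotationSystem X D)

/-- Planarity of a rotation system together with a bound on the distances from the root, expressed
as in `ContourMap.IsPlanar`: the antisymmetric functions `c` orthogonal to the functions on faces
have a potential. The values `f y` of the potential are attached to the initial points of darts. -/
def IsPlanar [Fintype D] (h : ℕ) : Prop :=
  ∀ c : D → ℝ, (∀ y, c (N.rev y) = -c y) →
    (∀ g : D → ℝ, (∀ y, g (N.next y) = g y) → ∑ y, g y * c y = 0) →
    ∃ f : D → ℝ, (∀ y, f (N.next y) = f (N.rev y)) ∧ (∀ y, f (N.rev y) = f y + c y) ∧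
      ((∀ y, c y ≤ 1) → ∀ y, f y ≤ f N.root + h)

/-- The outer contour is labelled by `w`; the contours of the other faces, read from the darts in
`cellRoots`, are labelled by relators. -/
structure IsFilling (R : Set (FreeGroup X)) (w : List (X × Bool)) (cellRoots : Finset D) :
    Prop where
  root_label : contourLabel N.next N.label N.root = w
  cell_label : ∀ a ∈ cellRoots, IsRelatorWord R (contourLabel N.next N.label a)
  cover : ∀ y, N.next.SameCycle N.root y ∨ ∃ a ∈ cellRoots, N.next.SameCycle a y

end RotationSystem

namespace ContourMap

variable {X D : Type*} (M : ContourMap X D)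

/-- The contours of all faces. -/
def contours : List (List D) := M.outer :: M.cells

theorem nodup_flatten_contours : M.contours.flatten.Nodup := M.nodup

theorem nodup_of_mem_contours {l : List D} (hl : l ∈ M.contours) : l.Nodup :=
  (List.nodup_flatten.1 M.nodup_flatten_contours).1 l hl

theorem mem_darts {y : D} : y ∈ M.darts ↔ ∃ l ∈ M.contours, y ∈ l :=
  List.mem_flatten (L := M.contours)

open Classical in
/-- The successor of a dart on the contour of its face. -/
noncomputable def next : Equiv.Perm D := (M.contours.map List.formPerm).prod

open Classical in
theorem next_apply {l : List D} (hl : l ∈ M.contours) {y : D} (hy : y ∈ l) :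
    M.next y = l.formPerm y :=
  prod_map_formPerm_apply M.nodup_flatten_contours hl hy

theorem next_mem {l : List D} (hl : l ∈ M.contours) {y : D} : M.next y ∈ l ↔ y ∈ l := by
  classical
  refine ⟨fun h => ?_, fun h => M.next_apply hl h ▸ List.formPerm_mem_iff_mem.2 h⟩
  have hpre : l.formPerm.symm (M.next y) ∈ l := by
    rwa [← List.formPerm_mem_iff_mem, Equiv.apply_symm_apply]
  have hnext : M.next (l.formPerm.symm (M.next y)) = M.next y := by
    rw [M.next_apply hl hpre, Equiv.apply_symm_apply]
  exact M.next.injective hnext ▸ hpre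

theorem next_iterate {l : List D} (hl : l ∈ M.contours) (i : ℕ) (hi : i < l.length) (k : ℕ) :
    M.next^[k] l[i] = l[(i + k) % l.length]'(Nat.mod_lt _ (Nat.zero_lt_of_lt hi)) := by
  classical
  induction k with
  | zero => simp [Nat.mod_eq_of_lt hi]
  | succ k ih =>
    rw [Function.iterate_succ_apply', ih, M.next_apply hl (List.getElem_mem _),
      List.formPerm_apply_getElem _ (M.nodup_of_mem_contours hl)]
    simp [add_assoc]

theorem exists_next_iterate {l : List D} (hl : l ∈ M.contours) {y z : D} (hy : y ∈ l)
    (hz : z ∈ l) : ∃ k, M.next^[k] y = z := by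
  obtain ⟨i, hi, rfl⟩ := List.getElem_of_mem hy
  obtain ⟨j, hj, rfl⟩ := List.getElem_of_mem hz
  refine ⟨l.length - i + j, ?_⟩
  rw [M.next_iterate hl i hi]
  congr 1
  rw [← add_assoc, Nat.add_sub_cancel' hi.le, Nat.add_mod_left, Nat.mod_eq_of_lt hj]

theorem IsPotential.apply_next {M : ContourMap X D} {c f : D → ℝ} {p : ℝ} (hc : M.IsCocycle c)
    (hf : M.IsPotential c f p) {y : D} (hy : y ∈ M.darts) : f (M.next y) = f (M.rev y) := by
  classical
  obtain ⟨l, hl, hyl⟩ := M.mem_darts.1 hy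
  have hsum : ∀ l ∈ M.contours, (l.map c).sum = 0 :=
    List.forall_mem_cons.2 ⟨hc.sum_outer, hc.sum_cell⟩
  have hpath : ∀ l ∈ M.contours, ∃ q, IsPotentialAlong f c q l :=
    List.forall_mem_cons.2 ⟨⟨p, hf.outer⟩, hf.cell⟩
  obtain ⟨q, hq⟩ := hpath l hl
  rw [M.next_apply hl hyl, hq.apply_formPerm (M.nodup_of_mem_contours hl) (hsum l hl) hyl,
    hf.rev y hy]

section Component

variable (hM : M.outer ≠ [])

/-- The dart belongs to the component of the outer contour. -/
def IsLive (y : D) : Prop := IsReachable M.rev M.next (M.outer.head hM) y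

variable {M hM} {y : D}

theorem IsLive.mem_darts (hy : M.IsLive hM y) : y ∈ M.darts := by
  induction hy with
  | root => exact M.mem_darts.2 ⟨_, List.mem_cons_self, List.head_mem hM⟩
  | rev _ ih => exact M.rev_mem_darts ih
  | next _ ih =>
    obtain ⟨l, hl, hy⟩ := M.mem_darts.1 ih
    exact M.mem_darts.2 ⟨l, hl, (M.next_mem hl).2 hy⟩

theorem IsLive.of_mem {l : List D} (hl : l ∈ M.contours) {z : D} (hy : M.IsLive hM y)
    (hyl : y ∈ l) (hz : z ∈ l) : M.IsLive hM z := by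
  obtain ⟨k, rfl⟩ := M.exists_next_iterate hl hyl hz
  exact hy.iterate_next k

theorem isLive_rev : M.IsLive hM (M.rev y) ↔ M.IsLive hM y :=
  ⟨fun h => M.rev_rev y ▸ h.rev, fun h => h.rev⟩

theorem isLive_next : M.IsLive hM (M.next y) ↔ M.IsLive hM y := by
  refine ⟨fun h => ?_, fun h => h.next⟩
  obtain ⟨l, hl, hy⟩ := M.mem_darts.1 h.mem_darts
  exact h.of_mem hl hy ((M.next_mem hl).1 hy)

variable (M hM)

instance finite_isLive : Finite {y // M.IsLive hM y} :=
  M.darts.finite_toSet.subset fun _ hy => IsLive.mem_darts hy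

/-- The component of the outer contour, as a rotation system. -/
noncomputable def component : RotationSystem X {y // M.IsLive hM y} where
  rev := M.rev_rev.toPerm.subtypePerm fun _ => isLive_rev
  next := M.next.subtypePerm fun _ => isLive_next
  label y := M.label y
  root := ⟨M.outer.head hM, .root⟩
  rev_rev y := Subtype.ext (M.rev_rev y)
  rev_ne y h := M.rev_ne y (congrArg Subtype.val h)
  label_rev y := M.label_rev y
  isReachable := by
    rintro ⟨y, hy⟩
    induction hy with
    | root => exact .root
    | rev hy ih => exact ih.rev
    | next hy ih => exact ih.next

variable {M hM}

theorem component_next_iterate (k : ℕ) (y : {y // M.IsLive hM y}) :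
    (((M.component hM).next^[k] y : {y // M.IsLive hM y}) : D) = M.next^[k] y := by
  induction k with
  | zero => rfl
  | succ k ih =>
    rw [Function.iterate_succ_apply', Function.iterate_succ_apply', ← ih]
    rfl

theorem component_sameCycle {l : List D} (hl : l ∈ M.contours) {y z : {y // M.IsLive hM y}}
    (hy : y.1 ∈ l) (hz : z.1 ∈ l) : (M.component hM).next.SameCycle y z := by
  obtain ⟨k, hk⟩ := M.exists_next_iterate hl hy hz
  refine ⟨k, Subtype.ext ?_⟩
  rw [zpow_natCast, Equiv.Perm.coe_pow, component_next_iterate, hk]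

theorem contourLabel_component {l : List D} (hl : l ∈ M.contours) (hne : l ≠ [])
    {a : {y // M.IsLive hM y}} (ha : a.1 = l.head hne) :
    contourLabel (M.component hM).next (M.component hM).label a = l.map M.label := by
  refine contourLabel_eq_map Subtype.val_injective (M.nodup_of_mem_contours hl)
    (List.length_pos_iff.2 hne) fun k => ?_
  rw [component_next_iterate, ha, List.head_eq_getElem, M.next_iterate hl]
  simp

variable (M hM)

open Classical in
/-- The initial darts of the contours of the cells in the component of the outer contour. -/
noncomputable def liveCellRoots : Finset {y // M.IsLive hM y} :=
  (M.cells.filterMap List.head?).toFinset.subtype (M.IsLive hM)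

variable {M hM}

theorem mem_liveCellRoots {a : {y // M.IsLive hM y}} :
    a ∈ M.liveCellRoots hM ↔ ∃ l ∈ M.cells, ∃ hl : l ≠ [], a.1 = l.head hl := by
  simp only [liveCellRoots, Finset.mem_subtype, List.mem_toFinset, List.mem_filterMap]
  refine exists_congr fun l => and_congr_right fun _ => ⟨fun h => ?_, fun ⟨hl, h⟩ => ?_⟩
  · exact ⟨by rintro rfl; simp at h, (List.head_of_head?_eq_some h).symm⟩
  · rw [List.head?_eq_some_head hl, h]

theorem card_liveCellRoots_le : (M.liveCellRoots hM).card ≤ M.cells.length := by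
  classical
  rw [liveCellRoots, Finset.card_subtype]
  exact (Finset.card_filter_le _ _).trans
    ((List.toFinset_card_le _).trans (List.length_filterMap_le _ _))

theorem isFilling_component {R : Set (FreeGroup X)}
    (hR : ∀ l ∈ M.cells, IsRelatorWord R (l.map M.label)) :
    (M.component hM).IsFilling R (M.outer.map M.label) (M.liveCellRoots hM) where
  root_label := contourLabel_component List.mem_cons_self hM rfl
  cell_label a ha := by
    obtain ⟨l, hl, hne, ha⟩ := mem_liveCellRoots.1 ha
    rw [contourLabel_component (List.mem_cons_of_mem _ hl) hne ha]
    exact hR l hl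
  cover y := by
    obtain ⟨l, hl, hy⟩ := M.mem_darts.1 y.2.mem_darts
    rcases List.mem_cons.1 hl with rfl | hcell
    · exact Or.inl (component_sameCycle hl (List.head_mem hM) hy)
    · have hne := List.ne_nil_of_mem hy
      exact Or.inr ⟨⟨l.head hne, y.2.of_mem hl hy (List.head_mem hne)⟩,
        mem_liveCellRoots.2 ⟨l, hcell, hne, rfl⟩, component_sameCycle hl (List.head_mem hne) hy⟩

/-- Cochains of the component are extended by zero to the other components. -/
theorem isCocycle_extend [Fintype {y // M.IsLive hM y}] {c : {y // M.IsLive hM y} → ℝ}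
    (hc : ∀ y, c ((M.component hM).rev y) = -c y)
    (hface : ∀ g : {y // M.IsLive hM y} → ℝ, (∀ y, g ((M.component hM).next y) = g y) →
      ∑ y, g y * c y = 0) :
    M.IsCocycle (Function.extend Subtype.val c 0) := by
  classical
  have hzero : ∀ y, ¬ M.IsLive hM y → Function.extend Subtype.val c 0 y = 0 := fun y hy =>
    Function.extend_apply' _ _ _ fun ⟨z, hz⟩ => hy (hz ▸ z.2)
  have hsum : ∀ l ∈ M.contours, (l.map (Function.extend Subtype.val c 0)).sum = 0 := by
    intro l hl
    rw [← List.sum_toFinset _ (M.nodup_of_mem_contours hl),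
      ← hface (fun y => if y.1 ∈ l then 1 else 0) fun y => by
        simp only [← M.next_mem hl (y := y.1)]; rfl]
    simp only [ite_mul, one_mul, zero_mul]
    rw [← Finset.sum_filter]
    refine (Finset.sum_of_injOn Subtype.val Subtype.val_injective.injOn (fun y hy => ?_)
      (fun y hy hy' => hzero y fun hlive => hy' ?_) fun y _ => ?_).symm
    · simpa using hy
    · exact ⟨⟨y, hlive⟩, by simpa using hy, rfl⟩
    · exact (Subtype.val_injective.extend_apply c 0 y).symm
  refine ⟨fun y => ?_, hsum _ List.mem_cons_self, fun l hl => hsum l (List.mem_cons_of_mem _ hl)⟩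
  by_cases hy : M.IsLive hM y
  · exact (Subtype.val_injective.extend_apply c 0 ⟨M.rev y, isLive_rev.2 hy⟩).trans
      ((hc ⟨y, hy⟩).trans (congrArg _ (Subtype.val_injective.extend_apply c 0 ⟨y, hy⟩).symm))
  · rw [hzero _ hy, hzero _ (mt isLive_rev.1 hy), neg_zero]

theorem IsPlanar.component [Fintype {y // M.IsLive hM y}] {h : ℕ} (H : M.IsPlanar h) :
    (M.component hM).IsPlanar h := by
  intro c hc hface
  have hcocycle := isCocycle_extend hc hface
  have hval : ∀ y : {y // M.IsLive hM y}, Function.extend Subtype.val c 0 y.1 = c y :=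
    Subtype.val_injective.extend_apply c 0
  obtain ⟨f, p, hf, hle⟩ := H _ hcocycle
  refine ⟨fun y => f y, fun y => hf.apply_next hcocycle y.2.mem_darts, fun y => ?_,
    fun hc₁ y => ?_⟩
  · rw [← hval]
    exact hf.rev y y.2.mem_darts
  · have hp : f (M.outer.head hM) = p := by
      simpa [List.head_eq_getElem] using
        hf.outer.apply_getElem 0 (List.length_pos_iff.2 hM)
    refine (hle (fun z => ?_) y y.2.mem_darts).trans_eq (congrArg (· + (h : ℝ)) hp.symm)
    by_cases hz : M.IsLive hM z
    · exact (hval ⟨z, hz⟩).trans_le (hc₁ _)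
    · rw [Function.extend_apply' _ _ _ fun ⟨z', hz'⟩ => hz (hz' ▸ z'.2)]
      exact zero_le_one

end Component

end ContourMap

/-! ## Euler's formula -/

section Antisymmetric

variable {D : Type*}

/-- The antisymmetric functions on darts, also known as `1`-cochains. -/
def antisymmetric (rev : Equiv.Perm D) : Submodule ℝ (D → ℝ) :=
  LinearMap.ker (LinearMap.funLeft ℝ ℝ rev + LinearMap.id)

theorem mem_antisymmetric {rev : Equiv.Perm D} {c : D → ℝ} :
    c ∈ antisymmetric rev ↔ ∀ y, c (rev y) = -c y := by
  simp [antisymmetric, funext_iff, eq_neg_iff_add_eq_zero, LinearMap.funLeft_apply]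

variable [Fintype D] {rev : Equiv.Perm D}

theorem two_mul_finrank_antisymmetric (hrev : ∀ y, rev (rev y) = y) (hne : ∀ y, rev y ≠ y) :
    2 * Module.finrank ℝ (antisymmetric rev) = Fintype.card D := by
  classical
  have hproj : LinearMap.IsProj (antisymmetric rev)
      ((2⁻¹ : ℝ) • (LinearMap.id - LinearMap.funLeft ℝ ℝ rev)) := by
    refine ⟨fun c => mem_antisymmetric.2 fun y => ?_, fun c hc => funext fun y => ?_⟩
    · simp only [LinearMap.smul_apply, LinearMap.sub_apply, LinearMap.id_apply, Pi.smul_apply,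
        Pi.sub_apply, LinearMap.funLeft_apply, hrev, smul_eq_mul]
      ring
    · simp only [LinearMap.smul_apply, LinearMap.sub_apply, LinearMap.id_apply, Pi.smul_apply,
        Pi.sub_apply, LinearMap.funLeft_apply, mem_antisymmetric.1 hc y, smul_eq_mul]
      ring
  have htrace := hproj.trace
  rw [LinearMap.trace_eq_matrix_trace ℝ (Pi.basisFun ℝ D), Matrix.trace] at htrace
  simp only [Matrix.diag_apply, LinearMap.toMatrix_apply, Pi.basisFun_apply, Pi.basisFun_repr,
    LinearMap.smul_apply, LinearMap.sub_apply, LinearMap.id_apply, Pi.smul_apply, Pi.sub_apply,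
    LinearMap.funLeft_apply, Pi.single_eq_same, Pi.single_eq_of_ne (hne _), sub_zero, smul_eq_mul,
    mul_one, Finset.sum_const, Finset.card_univ, nsmul_eq_mul] at htrace
  have hcard : (2 * Module.finrank ℝ (antisymmetric rev) : ℝ) = Fintype.card D := by linarith
  exact_mod_cast hcard

end Antisymmetric

theorem exists_mem_forall_sum_mul_sub_eq_zero {ι : Type*} [Fintype ι] (W : Submodule ℝ (ι → ℝ))
    (c : ι → ℝ) : ∃ u ∈ W, ∀ v ∈ W, ∑ i, v i * (c i - u i) = 0 := by
  obtain ⟨u, hu, z, hz, hc⟩ := (W.comap (WithLp.linearEquiv 2 ℝ (ι → ℝ)).toLinearMap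
    ).exists_add_mem_mem_orthogonal (WithLp.toLp 2 c)
  refine ⟨u.ofLp, hu, fun v hv => ?_⟩
  have horth := (Submodule.mem_orthogonal _ _).1 hz (WithLp.toLp 2 v) hv
  have hsub : ∀ i, c i - u.ofLp i = z.ofLp i := fun i => by
    rw [show c i = u.ofLp i + z.ofLp i from congrArg (fun x => x.ofLp i) hc, add_sub_cancel_left]
  simpa [PiLp.inner_apply, hsub, mul_comm] using horth

theorem apply_eq_of_sameCycle {D α : Type*} {σ : Equiv.Perm D} {f : D → α}
    (hf : ∀ y, f (σ y) = f y) {y z : D} (h : σ.SameCycle y z) : f y = f z := by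
  have hinv : ∀ y, f (σ⁻¹ y) = f y := fun y => by
    rw [← hf, ← Equiv.Perm.mul_apply, mul_inv_cancel, Equiv.Perm.one_apply]
  obtain ⟨n, rfl⟩ := h
  induction n using Int.induction_on with
  | zero => simp
  | succ n ih => rw [add_comm, zpow_one_add, Equiv.Perm.mul_apply, hf, ih]
  | pred n ih => rw [sub_eq_neg_add, zpow_add, zpow_neg_one, Equiv.Perm.mul_apply, hinv, ih]

namespace RotationSystem

variable {X D : Type*} (N : RotationSystem X D)

/-- The vertices of a rotation system: the classes of darts with the same initial point. -/
abbrev V : Type _ := Quotient (Equiv.Perm.SameCycle.setoid (N.next * N.rev))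

/-- The faces of a rotation system: the classes of darts with the same face on the left. -/
abbrev F : Type _ := Quotient (Equiv.Perm.SameCycle.setoid N.next)

/-- The initial vertex of a dart. -/
def src (y : D) : N.V := Quotient.mk _ y

/-- The face on the left of a dart. -/
def face (y : D) : N.F := Quotient.mk _ y

theorem src_eq_iff {y z : D} : N.src y = N.src z ↔ (N.next * N.rev).SameCycle y z := Quotient.eq

theorem face_eq_iff {y z : D} : N.face y = N.face z ↔ N.next.SameCycle y z := Quotient.eq

theorem src_next (y : D) : N.src (N.next y) = N.src (N.rev y) := by
  have h : N.src ((N.next * N.rev) (N.rev y)) = N.src (N.rev y) :=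
    N.src_eq_iff.2 (Equiv.Perm.sameCycle_apply_left.2 (.refl _ _))
  rwa [Equiv.Perm.mul_apply, N.rev_rev] at h

theorem face_next (y : D) : N.face (N.next y) = N.face y :=
  N.face_eq_iff.2 (Equiv.Perm.sameCycle_apply_left.2 (.refl _ _))

theorem exists_eq_comp_src {α : Type*} {f : D → α} (hf : ∀ y, f (N.next y) = f (N.rev y)) :
    ∃ f' : N.V → α, f = f' ∘ N.src :=
  ⟨Quotient.lift f fun _ _ => apply_eq_of_sameCycle fun y => by
    rw [Equiv.Perm.mul_apply, hf, N.rev_rev], rfl⟩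

theorem exists_eq_comp_face {α : Type*} {g : D → α} (hg : ∀ y, g (N.next y) = g y) :
    ∃ g' : N.F → α, g = g' ∘ N.face :=
  ⟨Quotient.lift g fun _ _ => apply_eq_of_sameCycle hg, rfl⟩

theorem eq_apply_root {α : Type*} {f : D → α} (hrev : ∀ y, f (N.rev y) = f y)
    (hnext : ∀ y, f (N.next y) = f y) (y : D) : f y = f N.root := by
  induction N.isReachable y with
  | root => rfl
  | rev _ ih => rw [hrev, ih]
  | next _ ih => rw [hnext, ih]

/-- The coboundary of a function on vertices. -/
def coboundary : (N.V → ℝ) →ₗ[ℝ] (D → ℝ) :=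
  LinearMap.funLeft ℝ ℝ (N.src ∘ N.rev) - LinearMap.funLeft ℝ ℝ N.src

/-- The coboundary, in the dual map, of a function on faces. -/
def dualCoboundary : (N.F → ℝ) →ₗ[ℝ] (D → ℝ) :=
  LinearMap.funLeft ℝ ℝ N.face - LinearMap.funLeft ℝ ℝ (N.face ∘ N.rev)

theorem coboundary_apply (f : N.V → ℝ) (y : D) :
    N.coboundary f y = f (N.src (N.rev y)) - f (N.src y) := rfl

theorem dualCoboundary_apply (g : N.F → ℝ) (y : D) :
    N.dualCoboundary g y = g (N.face y) - g (N.face (N.rev y)) := rfl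

theorem coboundary_rev (f : N.V → ℝ) (y : D) : N.coboundary f (N.rev y) = -N.coboundary f y := by
  simp only [coboundary_apply, N.rev_rev, neg_sub]

theorem dualCoboundary_rev (g : N.F → ℝ) (y : D) :
    N.dualCoboundary g (N.rev y) = -N.dualCoboundary g y := by
  simp only [dualCoboundary_apply, N.rev_rev, neg_sub]

theorem eq_const_of_coboundary_eq_zero {f : N.V → ℝ} (hf : N.coboundary f = 0) (v : N.V) :
    f v = f (N.src N.root) := by
  have hrev : ∀ y, f (N.src (N.rev y)) = f (N.src y) := fun y => sub_eq_zero.1 (congrFun hf y)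
  induction v using Quotient.inductionOn with
  | h y =>
    exact N.eq_apply_root (f := fun y => f (N.src y)) hrev
      (fun y => (congrArg f (N.src_next y)).trans (hrev y)) y

theorem eq_const_of_dualCoboundary_eq_zero {g : N.F → ℝ} (hg : N.dualCoboundary g = 0) (k : N.F) :
    g k = g (N.face N.root) := by
  have hrev : ∀ y, g (N.face (N.rev y)) = g (N.face y) := fun y =>
    (sub_eq_zero.1 (congrFun hg y)).symm
  induction k using Quotient.inductionOn with
  | h y =>
    exact N.eq_apply_root (f := fun y => g (N.face y)) hrev
      (fun y => congrArg g (N.face_next y)) y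

theorem sum_mul_coboundary [Fintype D] (g : N.F → ℝ) (f : N.V → ℝ) :
    ∑ y, g (N.face y) * N.coboundary f y = 0 := by
  simp only [coboundary_apply, mul_sub, Finset.sum_sub_distrib]
  rw [sub_eq_zero, ← Equiv.sum_comp N.next fun y => g (N.face y) * f (N.src y)]
  simp only [N.src_next, N.face_next]

theorem sum_dualCoboundary_mul [Fintype D] {c : D → ℝ} (hc : ∀ y, c (N.rev y) = -c y)
    (g : N.F → ℝ) :
    ∑ y, N.dualCoboundary g y * c y = 2 * ∑ y, g (N.face y) * c y := by
  simp only [dualCoboundary_apply, sub_mul, Finset.sum_sub_distrib]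
  rw [← Equiv.sum_comp N.rev fun y => g (N.face (N.rev y)) * c y]
  simp only [N.rev_rev, hc, mul_neg, Finset.sum_neg_distrib]
  ring

theorem coboundary_eq_zero_of_add_eq_zero [Finite D] {f : N.V → ℝ} {g : N.F → ℝ}
    (h : N.coboundary f + N.dualCoboundary g = 0) : N.coboundary f = 0 := by
  have := Fintype.ofFinite D
  have hsum : ∑ y, N.coboundary f y * N.coboundary f y = 0 := by
    rw [← neg_eq_zero, ← Finset.sum_neg_distrib]
    have hneg : ∀ y, -(N.coboundary f y * N.coboundary f y) =
        N.dualCoboundary g y * N.coboundary f y := fun y => by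
      rw [eq_neg_of_add_eq_zero_right h, Pi.neg_apply, neg_mul]
    simp only [hneg]
    rw [N.sum_dualCoboundary_mul (N.coboundary_rev f),
      N.sum_mul_coboundary, mul_zero]
  rw [Finset.sum_eq_zero_iff_of_nonneg fun _ _ => mul_self_nonneg _] at hsum
  exact funext fun y => mul_self_eq_zero.1 (hsum y (Finset.mem_univ y))

theorem finrank_ker_coprod [Finite D] :
    Module.finrank ℝ (LinearMap.ker (N.coboundary.coprod N.dualCoboundary)) = 2 := by
  have := Fintype.ofFinite D
  let const : ℝ × ℝ →ₗ[ℝ] (N.V → ℝ) × (N.F → ℝ) :=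
    (LinearMap.pi fun _ => LinearMap.id).prodMap (LinearMap.pi fun _ => LinearMap.id)
  have hconst : Function.Injective const := fun p q h =>
    Prod.ext (congrFun (congrArg Prod.fst h) (N.src N.root))
      (congrFun (congrArg Prod.snd h) (N.face N.root))
  have hker : LinearMap.ker (N.coboundary.coprod N.dualCoboundary) = LinearMap.range const := by
    refine le_antisymm ?_ ?_
    · rintro ⟨f, g⟩ hfg
      have hf : N.coboundary f = 0 := N.coboundary_eq_zero_of_add_eq_zero hfg
      have hg : N.dualCoboundary g = 0 := by
        simpa [hf] using hfg
      exact ⟨(f (N.src N.root), g (N.face N.root)),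
        Prod.ext (funext fun v => (N.eq_const_of_coboundary_eq_zero hf v).symm)
          (funext fun k => (N.eq_const_of_dualCoboundary_eq_zero hg k).symm)⟩
    · rintro _ ⟨p, rfl⟩
      ext y
      simp [const, coboundary_apply, dualCoboundary_apply]
  rw [hker, LinearMap.finrank_range_of_inj hconst, Module.finrank_prod, Module.finrank_self]

theorem IsPlanar.range_coprod [Fintype D] {N : RotationSystem X D} {h : ℕ} (H : N.IsPlanar h) :
    LinearMap.range (N.coboundary.coprod N.dualCoboundary) = antisymmetric N.rev := by
  refine le_antisymm ?_ fun c hc => ?_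
  · rintro _ ⟨⟨f, g⟩, rfl⟩
    refine mem_antisymmetric.2 fun y => ?_
    simp only [LinearMap.coprod_apply, Pi.add_apply, coboundary_rev, dualCoboundary_rev, neg_add]
  · obtain ⟨_, ⟨g, rfl⟩, horth⟩ :=
      exists_mem_forall_sum_mul_sub_eq_zero (LinearMap.range N.dualCoboundary) c
    have hanti : ∀ y, c (N.rev y) - N.dualCoboundary g (N.rev y) =
        -(c y - N.dualCoboundary g y) := fun y => by
      rw [mem_antisymmetric.1 hc, dualCoboundary_rev]
      ring
    obtain ⟨f, hnext, hrev, -⟩ := H (fun y => c y - N.dualCoboundary g y) hanti fun k hk => by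
      obtain ⟨k, rfl⟩ := N.exists_eq_comp_face hk
      have hsum := N.sum_dualCoboundary_mul (c := fun y => c y - N.dualCoboundary g y) hanti k
      rw [horth _ ⟨k, rfl⟩] at hsum
      simpa using hsum.symm
    obtain ⟨f, rfl⟩ := N.exists_eq_comp_src hnext
    refine ⟨(f, g), funext fun y => ?_⟩
    have hy : f (N.src (N.rev y)) = f (N.src y) + (c y - N.dualCoboundary g y) := hrev y
    rw [LinearMap.coprod_apply, Pi.add_apply, coboundary_apply]
    dsimp only
    rw [hy]
    ring

theorem IsPlanar.euler [Fintype D] {N : RotationSystem X D} [Fintype N.V] [Fintype N.F]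
    {h : ℕ} (H : N.IsPlanar h) :
    2 * (Fintype.card N.V + Fintype.card N.F) = Fintype.card D + 4 := by
  have hdim := LinearMap.finrank_range_add_finrank_ker (N.coboundary.coprod N.dualCoboundary)
  rw [H.range_coprod, N.finrank_ker_coprod, Module.finrank_prod,
    Module.finrank_fintype_fun_eq_card, Module.finrank_fintype_fun_eq_card] at hdim
  rw [← two_mul_finrank_antisymmetric N.rev_rev N.rev_ne, ← hdim]
  ring

/-! ## From contour maps to van Kampen diagrams -/

/-- The underlying graph of a rotation system. -/
def graph : SimpleGraph N.V :=
  SimpleGraph.fromRel fun u v => ∃ y, N.src y = u ∧ N.src (N.rev y) = v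

theorem src_eq_or_adj (y : D) :
    N.src y = N.src (N.rev y) ∨ N.graph.Adj (N.src y) (N.src (N.rev y)) :=
  or_iff_not_imp_left.2 fun h => (SimpleGraph.fromRel_adj _ _ _).2 ⟨h, Or.inl ⟨y, rfl, rfl⟩⟩

theorem reachable_src_rev (y : D) : N.graph.Reachable (N.src y) (N.src (N.rev y)) := by
  rcases N.src_eq_or_adj y with h | h
  exacts [h ▸ .refl _, h.reachable]

theorem connected : N.graph.Connected := by
  refine (SimpleGraph.connected_iff_exists_forall_reachable _).2 ⟨N.src N.root, fun v => ?_⟩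
  induction v using Quotient.inductionOn with
  | h y =>
    change N.graph.Reachable (N.src N.root) (N.src y)
    induction N.isReachable y with
    | root => exact .refl _
    | rev _ ih => exact ih.trans (N.reachable_src_rev _)
    | next _ ih => exact N.src_next _ ▸ ih.trans (N.reachable_src_rev _)

theorem dist_src_rev_le (v : N.V) (y : D) :
    N.graph.dist v (N.src (N.rev y)) ≤ N.graph.dist v (N.src y) + 1 := by
  rcases N.src_eq_or_adj y with h | h
  · exact h ▸ Nat.le_succ _
  · exact N.connected.dist_triangle.trans
      (Nat.add_le_add_left (SimpleGraph.dist_eq_one_iff_adj.2 h).le _)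

variable {N}

/-- The distance from the root is `1`-Lipschitz, and it is determined by its coboundary. -/
theorem IsPlanar.dist_le [Fintype D] {h : ℕ} (H : N.IsPlanar h) (y : D) :
    N.graph.dist (N.src N.root) (N.src y) ≤ h := by
  let δ : N.V → ℝ := fun v => N.graph.dist (N.src N.root) v
  obtain ⟨f, hnext, hrev, hle⟩ := H (N.coboundary δ) (N.coboundary_rev δ) fun g hg => by
    obtain ⟨g, rfl⟩ := N.exists_eq_comp_face hg
    exact N.sum_mul_coboundary g δ
  have hlip : ∀ y, N.coboundary δ y ≤ 1 := fun y => by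
    rw [coboundary_apply, sub_le_iff_le_add']
    exact (Nat.cast_le.2 (N.dist_src_rev_le (N.src N.root) y)).trans_eq (Nat.cast_succ _)
  have hconst : f y - δ (N.src y) = f N.root - δ (N.src N.root) :=
    N.eq_apply_root (f := fun y => f y - δ (N.src y))
      (fun y => by rw [hrev, coboundary_apply]; ring)
      (fun y => by rw [hnext, hrev, N.src_next, coboundary_apply]; ring) y
  have hroot : δ (N.src N.root) = 0 := by simp [δ]
  have hδ : δ (N.src y) ≤ h := by linarith [hle hlip y]
  exact Nat.cast_le.1 hδ

theorem IsPlanar.ediam_le [Fintype D] {h : ℕ} (H : N.IsPlanar h) :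
    N.graph.ediam ≤ (2 * h : ℕ) := by
  have hroot : ∀ v : N.V, N.graph.edist (N.src N.root) v ≤ h := fun v => by
    induction v using Quotient.inductionOn with
    | h y =>
      rw [← (N.connected _ _).coe_dist_eq_edist]
      exact_mod_cast H.dist_le y
  refine SimpleGraph.ediam_le_iff.2 fun u v => ?_
  refine (SimpleGraph.edist_triangle (v := N.src N.root)).trans ?_
  rw [two_mul, Nat.cast_add]
  exact add_le_add (SimpleGraph.edist_comm (G := N.graph) ▸ hroot u) (hroot v)

theorem IsFilling.exists_cellRoot {R : Set (FreeGroup X)} {w : List (X × Bool)}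
    {cellRoots : Finset D} (hN : N.IsFilling R w cellRoots) {k : N.F} (hk : k ≠ N.face N.root) :
    ∃ a ∈ cellRoots, N.face a = k := by
  obtain ⟨y, rfl⟩ := Quotient.mk_surjective k
  rcases hN.cover y with hy | ⟨a, ha, hay⟩
  · exact absurd (N.face_eq_iff.2 hy).symm hk
  · exact ⟨a, ha, N.face_eq_iff.2 hay⟩

end RotationSystem

open Classical in
/-- The van Kampen diagram given by a planar rotation system. -/
noncomputable def VanKampenDiagram.ofRotationSystem {X : Type*} {D : Type} [Fintype D]
    {N : RotationSystem X D} {R : Set (FreeGroup X)} {w : List (X × Bool)} {cellRoots : Finset D}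
    {h : ℕ} (hN : N.IsFilling R w cellRoots) (H : N.IsPlanar h) : VanKampenDiagram R w where
  V := N.V
  D := D
  F := N.F
  rev := N.rev
  rev_rev := N.rev_rev
  rev_ne := N.rev_ne
  next := N.next
  src := N.src
  face := N.face
  src_eq_iff _ _ := N.src_eq_iff
  face_eq_iff _ _ := N.face_eq_iff
  connected := N.connected
  euler := H.euler
  label := N.label
  label_rev := N.label_rev
  outer := N.face N.root
  cell_label k hk := by
    obtain ⟨a, ha, hak⟩ := hN.exists_cellRoot hk
    exact ⟨a, hak, _, rfl, (hN.cell_label a ha).2⟩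
  boundary_label := Or.inr ⟨N.root, rfl, hN.root_label.symm⟩

/-- The diagram consisting of one point. -/
def VanKampenDiagram.point {X : Type*} (R : Set (FreeGroup X)) : VanKampenDiagram R [] where
  V := Unit
  D := Empty
  F := Unit
  rev := 1
  rev_rev := nofun
  rev_ne := nofun
  next := 1
  src := Empty.elim
  face := Empty.elim
  src_eq_iff := nofun
  face_eq_iff := nofun
  connected := .of_subsingleton
  euler := rfl
  label := Empty.elim
  label_rev := nofun
  outer := ()
  cell_label _ hk := absurd rfl hk
  boundary_label := Or.inl ⟨inferInstance, rfl⟩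

section VanKampen

variable {X : Type*} {R : Set (FreeGroup X)} {w : List (X × Bool)} {A h : ℕ}

theorem VanKampenDiagram.area_ofRotationSystem_le {D : Type} [Fintype D] {N : RotationSystem X D}
    {cellRoots : Finset D} (hN : N.IsFilling R w cellRoots) (H : N.IsPlanar h) :
    (ofRotationSystem hN H).area ≤ cellRoots.card := by
  choose root hroot_mem hroot using fun k : {k : N.F // k ≠ N.face N.root} =>
    hN.exists_cellRoot k.2
  have hinj : Function.Injective fun k => (⟨root k, hroot_mem k⟩ : cellRoots) := fun k l hkl =>
    Subtype.ext ((hroot k).symm.trans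
      ((congrArg (N.face ∘ Subtype.val) hkl).trans (hroot l)))
  exact (Nat.card_le_card_of_injective _ hinj).trans_eq (by simp)

theorem HasPlanarFilling.exists_diagram (H : HasPlanarFilling R w A h) :
    ∃ Δ : VanKampenDiagram R w, Δ.area ≤ A ∧ Δ.diameter ≤ (2 * h : ℕ) := by
  obtain ⟨D, M, rfl, hcells, hA, hplanar⟩ := H
  rcases eq_or_ne M.outer [] with hM | hM
  · rw [hM]
    refine ⟨.point R, ?_, ?_⟩
    · have : IsEmpty {f : Unit // f ≠ ()} := ⟨fun f => f.2 rfl⟩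
      exact (Nat.card_of_isEmpty (α := {f : Unit // f ≠ ()})).trans_le (Nat.zero_le A)
    · exact (SimpleGraph.ediam_eq_zero_of_subsingleton (α := Unit)).trans_le zero_le
  · have := Fintype.ofFinite {y // M.IsLive hM y}
    have hfill := ContourMap.isFilling_component (hM := hM) hcells
    exact ⟨.ofRotationSystem hfill hplanar.component,
      (VanKampenDiagram.area_ofRotationSystem_le hfill _).trans
        (ContourMap.card_liveCellRoots_le.trans hA), hplanar.component.ediam_le⟩

/-- **Van Kampen's lemma**. -/
theorem IsConjProd.exists_diagram [DecidableEq X] {M : ℕ} (hR : ∀ r ∈ R, r.norm ≤ M)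
    (H : IsConjProd R h A (FreeGroup.mk w)) :
    ∃ Δ : VanKampenDiagram R w, Δ.area ≤ A ∧ Δ.diameter ≤ (2 * max (h + M) w.length : ℕ) :=
  (H.hasPlanarFilling hR).exists_diagram

end VanKampen

/-! ## Grids in spaces with simply connected asymptotic cones -/

/-- The closed polygon `u 0, …, u k` based at `o` bounds a `k × k` square grid `g` with meshes of
side at most `ε`: the polygon is the bottom side, and the three other sides are constant. -/
structure IsGridFilling {M : Type*} [PseudoMetricSpace M] (k : ℕ) (ε : ℝ) (u : ℕ → M) (o : M)
    (g : ℕ → ℕ → M) : Prop where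
  bottom : ∀ a ≤ k, g a 0 = u a
  top : ∀ a ≤ k, g a k = o
  left : ∀ b ≤ k, g 0 b = o
  right : ∀ b ≤ k, g k b = o
  dist_vertical_le : ∀ a ≤ k, ∀ b < k, dist (g a b) (g a (b + 1)) ≤ ε
  dist_horizontal_le : ∀ a < k, ∀ b ≤ k, dist (g a b) (g (a + 1) b) ≤ ε

section Homotopy

open scoped unitInterval

/-- The point `i / k` of the unit interval, for `i ≤ k`. -/
noncomputable def gridPoint (k i : ℕ) : I := Set.projIcc 0 1 zero_le_one (i / k : ℝ)

theorem gridPoint_zero (k : ℕ) : gridPoint k 0 = 0 := by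
  simp [gridPoint, Set.projIcc_left, unitInterval]

theorem gridPoint_self {k : ℕ} (hk : k ≠ 0) : gridPoint k k = 1 := by
  rw [gridPoint, div_self (Nat.cast_ne_zero.2 hk)]
  exact Set.projIcc_right (zero_le_one (α := ℝ))

theorem coe_gridPoint {k i : ℕ} (hi : i ≤ k) : (gridPoint k i : ℝ) = i / k := by
  have h : (i / k : ℝ) ∈ Set.Icc (0 : ℝ) 1 :=
    ⟨by positivity, div_le_one_of_le₀ (by exact_mod_cast hi) (by positivity)⟩
  exact congrArg Subtype.val (Set.projIcc_of_mem zero_le_one h)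

theorem dist_gridPoint_succ_le (k i : ℕ) :
    dist (gridPoint k i) (gridPoint k (i + 1)) ≤ 1 / k := by
  have h : LipschitzWith 1 (Set.projIcc (0 : ℝ) 1 zero_le_one) := LipschitzWith.projIcc _
  refine (h.dist_le_mul _ _).trans ?_
  rw [Real.dist_eq, NNReal.coe_one, one_mul, ← sub_div, abs_div]
  simp

theorem exists_isGridFilling_of_homotopic_refl {Y : Type*} [PseudoMetricSpace Y] {y : Y}
    {p : Path y y} (hp : p.Homotopic (Path.refl y)) {ε : ℝ} (hε : 0 < ε) :
    ∃ k₀, ∀ k ≥ k₀, ∃ g, IsGridFilling k ε (fun a => p (gridPoint k a)) y g := by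
  obtain ⟨H⟩ := hp
  obtain ⟨δ, hδ, hH⟩ := Metric.uniformContinuous_iff.1
    (CompactSpace.uniformContinuous_of_continuous H.continuous) ε hε
  obtain ⟨n, hn⟩ := exists_nat_one_div_lt hδ
  refine ⟨n + 1, fun k hk => ⟨fun a b => H (gridPoint k b, gridPoint k a), ?_⟩⟩
  have hk₀ : k ≠ 0 := by omega
  have hmesh (i : ℕ) : dist (gridPoint k i) (gridPoint k (i + 1)) < δ := by
    refine (dist_gridPoint_succ_le k i).trans_lt (lt_of_le_of_lt ?_ hn)
    exact one_div_le_one_div_of_le (by positivity) (by exact_mod_cast hk)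
  exact
    { bottom := fun a _ => by simp [gridPoint_zero]
      top := fun a _ => by simp [gridPoint_self hk₀]
      left := fun b _ => by simp [gridPoint_zero]
      right := fun b _ => by simp [gridPoint_self hk₀]
      dist_vertical_le := fun a _ b _ => (hH (max_lt (hmesh b) (by simpa using hδ))).le
      dist_horizontal_le := fun a _ b _ => (hH (max_lt (by simpa using hδ) (hmesh a))).le }

end Homotopy

section Cone

open scoped unitInterval

variable {M : Type*} [PseudoMetricSpace M] {ω : Ultrafilter ℕ} {d : ScalingConstants} {o : ℕ → M}

/-- The point of the asymptotic cone represented by a bounded sequence. -/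
noncomputable def AsymptoticCone.mk (x : BoundedSeq M ω d o) : AsymptoticCone M ω d o :=
  SeparationQuotient.mk x

theorem AsymptoticCone.mk_surjective :
    Function.Surjective (AsymptoticCone.mk : BoundedSeq M ω d o → AsymptoticCone M ω d o) :=
  SeparationQuotient.surjective_mk

theorem AsymptoticCone.eventually_dist_le {x y : BoundedSeq M ω d o} {ε ε' : ℝ}
    (h : dist (mk x) (mk y) ≤ ε) (hε : ε < ε') :
    ∀ᶠ i in (ω : Filter ℕ), dist (x.1 i) (y.1 i) ≤ ε' * d.val i := by
  filter_upwards [(x.tendsto_limDist y).eventually_lt_const (h.trans_lt hε)] with i hi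
  exact ((div_lt_iff₀ (d.pos i)).1 hi).le

theorem IsGridFilling.eventually_exists {k : ℕ} {ε ε' : ℝ} {u : ℕ → BoundedSeq M ω d o}
    {x₀ : BoundedSeq M ω d o} {g : ℕ → ℕ → AsymptoticCone M ω d o}
    (hg : IsGridFilling k ε (fun a => .mk (u a)) (.mk x₀) g) (hu₀ : u 0 = x₀) (huk : u k = x₀)
    (hε : ε < ε') :
    ∀ᶠ i in (ω : Filter ℕ), ∃ f,
      IsGridFilling k (ε' * d.val i) (fun a => (u a).1 i) (x₀.1 i) f := by
  let x (a b : ℕ) : BoundedSeq M ω d o :=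
    if b = 0 then u a else if b = k ∨ a = 0 ∨ a = k then x₀ else
      Function.surjInv AsymptoticCone.mk_surjective (g a b)
  have hx {a b : ℕ} (ha : a ≤ k) (hb : b ≤ k) : .mk (x a b) = g a b := by
    simp only [x]
    split_ifs with hb₀ hside
    · rw [hb₀, hg.bottom a ha]
    · rcases hside with rfl | rfl | rfl
      exacts [(hg.top a ha).symm, (hg.left b hb).symm, (hg.right b hb).symm]
    · exact Function.surjInv_eq AsymptoticCone.mk_surjective _
  have hvertical : ∀ᶠ i in (ω : Filter ℕ), ∀ a ∈ Set.Iic k, ∀ b ∈ Set.Iio k,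
      dist ((x a b).1 i) ((x a (b + 1)).1 i) ≤ ε' * d.val i := by
    refine ((Set.finite_Iic k).eventually_all).2 fun a ha =>
      ((Set.finite_Iio k).eventually_all).2 fun b hb => ?_
    refine AsymptoticCone.eventually_dist_le ?_ hε
    rw [hx ha hb.le, hx ha hb]
    exact hg.dist_vertical_le a ha b hb
  have hhorizontal : ∀ᶠ i in (ω : Filter ℕ), ∀ a ∈ Set.Iio k, ∀ b ∈ Set.Iic k,
      dist ((x a b).1 i) ((x (a + 1) b).1 i) ≤ ε' * d.val i := by
    refine ((Set.finite_Iio k).eventually_all).2 fun a ha =>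
      ((Set.finite_Iic k).eventually_all).2 fun b hb => ?_
    refine AsymptoticCone.eventually_dist_le ?_ hε
    rw [hx ha.le hb, hx ha hb]
    exact hg.dist_horizontal_le a ha b hb
  filter_upwards [hvertical, hhorizontal] with i hv hh
  refine ⟨fun a b => (x a b).1 i, fun a _ => by simp [x], fun a ha => ?_, fun b _ => ?_,
    fun b _ => ?_, hv, hh⟩
  · rcases Nat.eq_zero_or_pos k with rfl | hk
    · simp [x, Nat.le_zero.1 ha, hu₀]
    · simp [x, hk.ne']
  · by_cases hb : b = 0 <;> simp [x, hb, hu₀]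
  · by_cases hb : b = 0 <;> simp [x, hb, huk]

/-- The curves `γ i` are uniformly coarsely Lipschitz after rescaling by `d`. -/
def IsCoarselyLipschitz (d : ScalingConstants) (C : ℝ) (γ : ℕ → I → M) : Prop :=
  ∀ i s t, dist (γ i s) (γ i t) ≤ C * dist s t * d.val i + C

namespace IsCoarselyLipschitz

variable {C : ℝ} {γ : ℕ → I → M}

theorem nonneg (hγ : IsCoarselyLipschitz d C γ) : 0 ≤ C := by
  simpa using hγ 0 0 0

theorem limDist_le (hω : (ω : Filter ℕ) ≤ cofinite) (hγ : IsCoarselyLipschitz d C γ)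
    {x y : BoundedSeq M ω d o} {s t : I} (hx : ∀ i, x.1 i = γ i s) (hy : ∀ i, y.1 i = γ i t) :
    x.limDist y ≤ C * dist s t := by
  have hd : Tendsto d.val (ω : Filter ℕ) atTop :=
    d.tendsto.mono_left (hω.trans Nat.cofinite_eq_atTop.le)
  have hlim : Tendsto (fun i => C * dist s t + C / d.val i) (ω : Filter ℕ)
      (𝓝 (C * dist s t + 0)) := tendsto_const_nhds.add (hd.const_div_atTop C)
  rw [add_zero] at hlim
  refine le_of_tendsto_of_tendsto' (x.tendsto_limDist y) hlim fun i => ?_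
  rw [div_le_iff₀ (d.pos i), add_mul, div_mul_cancel₀ _ (d.pos i).ne', hx, hy]
  exact hγ i s t

theorem exists_eventually_dist_div_le (hω : (ω : Filter ℕ) ≤ cofinite)
    (hγ : IsCoarselyLipschitz d C γ) (h₀ : ∀ i, γ i 0 = o i) (t : I) :
    ∃ B, ∀ᶠ i in (ω : Filter ℕ), dist (γ i t) (o i) / d.val i ≤ B := by
  have hd : Tendsto d.val (ω : Filter ℕ) atTop :=
    d.tendsto.mono_left (hω.trans Nat.cofinite_eq_atTop.le)
  refine ⟨C * dist t 0 + C, ?_⟩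
  filter_upwards [hd.eventually_ge_atTop 1] with i hi
  rw [← h₀, div_le_iff₀ (d.pos i), add_mul]
  exact (hγ i t 0).trans (by gcongr; exact le_mul_of_one_le_right hγ.nonneg hi)

theorem eventually_exists_isGridFilling (hω : (ω : Filter ℕ) ≤ cofinite)
    [SimplyConnectedSpace (AsymptoticCone M ω d o)] (hγ : IsCoarselyLipschitz d C γ)
    (h₀ : ∀ i, γ i 0 = o i) (h₁ : ∀ i, γ i 1 = o i) {ε : ℝ} (hε : 0 < ε) :
    ∃ k₀, ∀ k ≥ k₀, ∀ᶠ i in (ω : Filter ℕ),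
      ∃ g, IsGridFilling k (ε * d.val i) (fun a => γ i (gridPoint k a)) (o i) g := by
  let x₀ : BoundedSeq M ω d o := ⟨o, 0, by simp⟩
  let x (t : I) : BoundedSeq M ω d o :=
    ⟨fun i => γ i t, hγ.exists_eventually_dist_div_le hω h₀ t⟩
  have hx₀ : x 0 = x₀ := Subtype.ext (funext h₀)
  have hx₁ : x 1 = x₀ := Subtype.ext (funext h₁)
  have hcont : Continuous fun t => AsymptoticCone.mk (x t) :=
    (LipschitzWith.of_dist_le_mul (K := ⟨C, hγ.nonneg⟩) fun _ _ =>
      hγ.limDist_le hω (fun _ => rfl) fun _ => rfl).continuous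
  let p : Path (AsymptoticCone.mk x₀) (AsymptoticCone.mk x₀) :=
    ⟨⟨fun t => AsymptoticCone.mk (x t), hcont⟩, by simp [hx₀], by simp [hx₁]⟩
  obtain ⟨k₀, hk₀⟩ := exists_isGridFilling_of_homotopic_refl
    (SimplyConnectedSpace.paths_homotopic p (Path.refl _)) (half_pos hε)
  refine ⟨k₀ + 1, fun k hk => ?_⟩
  obtain ⟨g, hg⟩ := hk₀ k (by omega)
  refine IsGridFilling.eventually_exists (u := fun a => x (gridPoint k a)) hg ?_ ?_
    (half_lt_self hε)
  · rw [gridPoint_zero, hx₀]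
  · rw [gridPoint_self (by omega), hx₁]

end IsCoarselyLipschitz

end Cone

section WordCurve

variable {G : Type*} [Group G] {S : Finset G} {X : Type*}

theorem exists_wordLength_map_mk_le [Finite X] (hS : Subgroup.closure (S : Set G) = ⊤)
    (φ : FreeGroup X →* G) :
    ∃ C : ℕ, ∀ w, wordLength S (φ (FreeGroup.mk w)) ≤ C * w.length := by
  obtain ⟨C, hC⟩ := (Set.finite_range fun x => wordLength S (φ (FreeGroup.of x))).bddAbove
  have hgen (x : X) : wordLength S (φ (FreeGroup.of x)) ≤ C := hC ⟨x, rfl⟩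
  have hletter (x : X × Bool) : wordLength S (φ (FreeGroup.mk [x])) ≤ C := by
    rcases x with ⟨x, _ | _⟩
    · rw [show FreeGroup.mk [(x, false)] = (FreeGroup.of x)⁻¹ from rfl, map_inv]
      exact (wordLength_inv_le hS _).trans (hgen x)
    · exact hgen x
  refine ⟨C, fun w => ?_⟩
  induction w with
  | nil => simp [← FreeGroup.one_eq_mk, wordLength_one]
  | cons x w ih =>
    rw [← List.singleton_append, ← FreeGroup.mul_mk, map_mul, List.length_append,
      List.length_singleton, Nat.mul_add, mul_one]
    exact (wordLength_mul_le hS _ _).trans (Nat.add_le_add (hletter x) ih)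

theorem mk_take_inv_mul_mk_take {w : List (X × Bool)} {a b : ℕ} (hab : a ≤ b) :
    (FreeGroup.mk (w.take a))⁻¹ * FreeGroup.mk (w.take b) =
      FreeGroup.mk ((w.take b).drop a) := by
  have h : w.take b = w.take a ++ (w.take b).drop a := by
    conv_lhs => rw [← List.take_append_drop a (w.take b), List.take_take, min_eq_left hab]
  rw [inv_mul_eq_iff_eq_mul, FreeGroup.mul_mk, ← h]

/-- The value in `G` of the prefix of length `a` of the word `w`, as a point of the word metric. -/
def prefixPoint (hS : Subgroup.closure (S : Set G) = ⊤) (φ : FreeGroup X →* G)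
    (w : List (X × Bool)) (a : ℕ) : WordMetric S hS :=
  φ (FreeGroup.mk (w.take a))

/-- The loop in the word metric read along `w`, parametrized by the unit interval. -/
noncomputable def prefixCurve (hS : Subgroup.closure (S : Set G) = ⊤) (φ : FreeGroup X →* G)
    (w : List (X × Bool)) (t : unitInterval) : WordMetric S hS :=
  prefixPoint hS φ w ⌊(t : ℝ) * w.length⌋₊

variable {hS : Subgroup.closure (S : Set G) = ⊤} {φ : FreeGroup X →* G} {w : List (X × Bool)}

theorem prefixCurve_zero : prefixCurve hS φ w 0 = WordMetric.basepoint S hS := by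
  simp only [prefixCurve, prefixPoint, Set.Icc.coe_zero, zero_mul, Nat.floor_zero, List.take_zero]
  exact map_one φ

theorem prefixCurve_one (hw : φ (FreeGroup.mk w) = 1) :
    prefixCurve hS φ w 1 = WordMetric.basepoint S hS := by
  simp only [prefixCurve, prefixPoint, Set.Icc.coe_one, one_mul, Nat.floor_natCast,
    List.take_length]
  exact hw

theorem prefixCurve_gridPoint {k a : ℕ} (ha : a ≤ k) :
    prefixCurve hS φ w (gridPoint k a) = prefixPoint hS φ w (a * w.length / k) := by
  rw [prefixCurve, coe_gridPoint ha, div_mul_eq_mul_div, ← Nat.cast_mul, Nat.floor_div_eq_div]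

theorem dist_prefixPoint_le {C : ℕ} (hC : ∀ w, wordLength S (φ (FreeGroup.mk w)) ≤ C * w.length)
    (a b : ℕ) : dist (prefixPoint hS φ w a) (prefixPoint hS φ w b) ≤ C * |(a : ℝ) - b| := by
  wlog hab : a ≤ b generalizing a b
  · rw [dist_comm, abs_sub_comm]
    exact this b a (le_of_not_ge hab)
  have hle : wordLength S ((φ (FreeGroup.mk (w.take a)))⁻¹ * φ (FreeGroup.mk (w.take b))) ≤
      C * (b - a) := by
    rw [← map_inv, ← map_mul, mk_take_inv_mul_mk_take hab]
    refine (hC _).trans (Nat.mul_le_mul_left _ ?_)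
    rw [List.length_drop, List.length_take]
    omega
  have habs : |(a : ℝ) - b| = ((b - a : ℕ) : ℝ) := by
    rw [abs_sub_comm, Nat.cast_sub hab, abs_of_nonneg (sub_nonneg.2 (Nat.cast_le.2 hab))]
  rw [habs]
  exact (Nat.cast_le.2 hle).trans_eq (Nat.cast_mul _ _)

theorem abs_natFloor_sub_natFloor_le {x y : ℝ} (hx : 0 ≤ x) (hy : 0 ≤ y) :
    |(⌊x⌋₊ : ℝ) - ⌊y⌋₊| ≤ |x - y| + 1 := by
  have hx₁ := Nat.floor_le hx
  have hx₂ := Nat.lt_floor_add_one x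
  have hy₁ := Nat.floor_le hy
  have hy₂ := Nat.lt_floor_add_one y
  have hxy := abs_le.1 (le_refl |x - y|)
  exact abs_le.2 ⟨by linarith, by linarith⟩

theorem dist_prefixCurve_le {C : ℕ} (hC : ∀ w, wordLength S (φ (FreeGroup.mk w)) ≤ C * w.length)
    (s t : unitInterval) :
    dist (prefixCurve hS φ w s) (prefixCurve hS φ w t) ≤ C * dist s t * w.length + C :=
  calc dist (prefixCurve hS φ w s) (prefixCurve hS φ w t)
      ≤ C * |(⌊(s : ℝ) * w.length⌋₊ : ℝ) - ⌊(t : ℝ) * w.length⌋₊| := dist_prefixPoint_le hC _ _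
    _ ≤ C * (|(s : ℝ) * w.length - t * w.length| + 1) := by
        gcongr
        exact abs_natFloor_sub_natFloor_le (mul_nonneg s.2.1 (Nat.cast_nonneg _))
          (mul_nonneg t.2.1 (Nat.cast_nonneg _))
    _ = C * dist s t * w.length + C := by
        rw [← sub_mul, abs_mul, Nat.abs_cast, Subtype.dist_eq, Real.dist_eq]
        ring

/-- The loop read along `w` bounds a `k × k` grid with meshes of side at most `ε * |w|`. -/
def HasGridFilling (hS : Subgroup.closure (S : Set G) = ⊤) (φ : FreeGroup X →* G) (ε : ℝ) (k : ℕ)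
    (w : List (X × Bool)) : Prop :=
  ∃ g, IsGridFilling k (ε * w.length) (fun a => prefixPoint hS φ w (a * w.length / k))
    (WordMetric.basepoint S hS) g

/-- The scaling constants `n i + 1`, which are positive even where `n i = 0`. -/
def ScalingConstants.ofStrictMono {n : ℕ → ℕ} (hn : StrictMono n) : ScalingConstants where
  val i := n i + 1
  pos i := by positivity
  mono i j hij := by simpa using hn.monotone hij
  tendsto := tendsto_atTop_add_const_right _ _
    (tendsto_natCast_atTop_atTop.comp hn.tendsto_atTop)

variable {ω : Ultrafilter ℕ} {ε : ℝ}

theorem eventually_hasGridFilling [Finite X] (hω : (ω : Filter ℕ) ≤ cofinite)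
    (hcones : ∀ d, SimplyConnectedSpace
      (AsymptoticCone (WordMetric S hS) ω d fun _ => WordMetric.basepoint S hS))
    {w : ℕ → List (X × Bool)} (hw : StrictMono fun i => (w i).length)
    (hφw : ∀ i, φ (FreeGroup.mk (w i)) = 1) (hε : 0 < ε) :
    ∃ k₀, ∀ k ≥ k₀, ∀ᶠ i in (ω : Filter ℕ), HasGridFilling hS φ ε k (w i) := by
  let d := ScalingConstants.ofStrictMono hw
  have := hcones d
  obtain ⟨C, hC⟩ := exists_wordLength_map_mk_le hS φ
  have hcurve : IsCoarselyLipschitz d C fun i => prefixCurve hS φ (w i) := fun i s t => by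
    refine (dist_prefixCurve_le hC s t).trans ?_
    gcongr
    exact le_add_of_nonneg_right zero_le_one
  obtain ⟨k₀, hk₀⟩ := hcurve.eventually_exists_isGridFilling hω (fun _ => prefixCurve_zero)
    (fun i => prefixCurve_one (hφw i)) (half_pos hε)
  refine ⟨k₀, fun k hk => ?_⟩
  filter_upwards [hk₀ k hk, (hω.trans Nat.cofinite_eq_atTop.le) (eventually_ge_atTop 1)]
    with i ⟨g, hg⟩ hi
  have hlen : (1 : ℝ) ≤ (w i).length := Nat.one_le_cast.2 (hi.trans (hw.id_le i))
  have hmesh : ε / 2 * d.val i ≤ ε * (w i).length := by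
    change ε / 2 * ((w i).length + 1) ≤ _
    nlinarith
  exact ⟨g, { hg with
    bottom := fun a ha => (hg.bottom a ha).trans (prefixCurve_gridPoint ha)
    dist_vertical_le := fun a ha b hb => (hg.dist_vertical_le a ha b hb).trans hmesh
    dist_horizontal_le := fun a ha b hb => (hg.dist_horizontal_le a ha b hb).trans hmesh }⟩

/-- Otherwise there are arbitrarily long trivial words `w i` without a `k × k` grid for all `k` from
`q` to `i`, which contradicts the simple connectivity of the cone with scaling constants `|w i|`. -/
theorem exists_forall_hasGridFilling [Finite X] (hω : (ω : Filter ℕ) ≤ cofinite)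
    (hcones : ∀ d, SimplyConnectedSpace
      (AsymptoticCone (WordMetric S hS) ω d fun _ => WordMetric.basepoint S hS))
    (φ : FreeGroup X →* G) (q : ℕ) (hε : 0 < ε) :
    ∃ m N : ℕ, ∀ w : List (X × Bool), N ≤ w.length → φ (FreeGroup.mk w) = 1 →
      ∃ k, q ≤ k ∧ k ≤ m ∧ HasGridFilling hS φ ε k w := by
  by_contra! hcon
  obtain ⟨n, hn, hw⟩ := Filter.extraction_forall_of_frequently
    (P := fun m n => ∃ w : List (X × Bool), w.length = n ∧ φ (FreeGroup.mk w) = 1 ∧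
      ∀ k, q ≤ k → k ≤ m → ¬HasGridFilling hS φ ε k w) fun m =>
    Filter.frequently_atTop.2 fun N =>
      let ⟨w, hN, hφw, hgrid⟩ := hcon m N
      ⟨w.length, hN, w, rfl, hφw, hgrid⟩
  choose w hlen hφw hgrid using hw
  obtain ⟨k₀, hk₀⟩ := eventually_hasGridFilling hω hcones (w := w)
    (by simpa only [hlen] using hn) hφw hε
  obtain ⟨i, hi, hik⟩ := ((hk₀ (max k₀ q) (le_max_left _ _)).and
    ((hω.trans Nat.cofinite_eq_atTop.le) (eventually_ge_atTop (max k₀ q)))).exists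
  exact hgrid i _ (le_max_right _ _) hik hi

end WordCurve

/-! ## Decomposition of trivial words -/

section Lattice

variable {X : Type*} [DecidableEq X] {T : Set (FreeGroup X)} {k m L : ℕ}

/-- `p` and `p'` label the paths along the lower and the upper side of a strip of `k` meshes, from
the left end, and `v` labels the vertical edges between them. -/
theorem isConjProd_strip {p p' v : ℕ → FreeGroup X} (h₀ : p 0 * v 0 * (p' 0)⁻¹ = 1)
    (hp : ∀ a < k, (p a).norm ≤ L)
    (hT : ∀ a < k, (p a)⁻¹ * p (a + 1) * v (a + 1) * ((p' a)⁻¹ * p' (a + 1))⁻¹ * (v a)⁻¹ ∈ T) :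
    IsConjProd T L k (p k * v k * (p' k)⁻¹) := by
  induction k with
  | zero => exact h₀ ▸ .one
  | succ k ih =>
    convert IsConjProd.cons (hp k k.lt_succ_self) (Or.inl (hT k k.lt_succ_self))
      (ih (fun a ha => hp a (ha.trans k.lt_succ_self))
        fun a ha => hT a (ha.trans k.lt_succ_self)) using 1
    group

theorem isConjProd_lattice {p v : ℕ → ℕ → FreeGroup X}
    (hleft : ∀ b < m, p 0 b * v 0 b * (p 0 (b + 1))⁻¹ = 1) (hright : ∀ b < m, v k b = 1)
    (hp : ∀ a < k, ∀ b < m, (p a b).norm ≤ L)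
    (hT : ∀ a < k, ∀ b < m, (p a b)⁻¹ * p (a + 1) b * v (a + 1) b *
      ((p a (b + 1))⁻¹ * p (a + 1) (b + 1))⁻¹ * (v a b)⁻¹ ∈ T) :
    IsConjProd T L (m * k) (p k 0 * (p k m)⁻¹) := by
  induction m with
  | zero => simpa using IsConjProd.one
  | succ m ih =>
    have hm := m.lt_succ_self
    have hlower := ih (fun b hb => hleft b (hb.trans hm)) (fun b hb => hright b (hb.trans hm))
      (fun a ha b hb => hp a ha b (hb.trans hm)) (fun a ha b hb => hT a ha b (hb.trans hm))
    have hstrip := isConjProd_strip (hleft m hm) (fun a ha => hp a ha m hm)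
      (fun a ha => hT a ha m hm)
    rw [Nat.succ_mul]
    convert hlower.mul hstrip using 1
    rw [hright m hm]
    group

theorem norm_le_mul_of_norm_inv_mul_le {p : ℕ → FreeGroup X} (h₀ : p 0 = 1)
    (hp : ∀ a < k, ((p a)⁻¹ * p (a + 1)).norm ≤ L) {a : ℕ} (ha : a ≤ k) : (p a).norm ≤ a * L := by
  induction a with
  | zero => simp [h₀]
  | succ a ih =>
    calc (p (a + 1)).norm = (p a * ((p a)⁻¹ * p (a + 1))).norm := by rw [mul_inv_cancel_left]
      _ ≤ a * L + L := (FreeGroup.norm_mul_le _ _).trans (Nat.add_le_add (ih (by omega)) (hp a ha))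
      _ = (a + 1) * L := (Nat.succ_mul a L).symm

theorem norm_mul_mul_inv_mul_inv_le (x y z t : FreeGroup X) :
    (x * y * z⁻¹ * t⁻¹).norm ≤ x.norm + y.norm + z.norm + t.norm := by
  have h₁ := FreeGroup.norm_mul_le (x * y * z⁻¹) t⁻¹
  have h₂ := FreeGroup.norm_mul_le (x * y) z⁻¹
  have h₃ := FreeGroup.norm_mul_le x y
  simp only [FreeGroup.norm_inv_eq] at h₁ h₂
  omega

end Lattice

section LiftPath

variable {G F : Type*} [Group G] [Group F]

/-- The lift of a path in `G` starting at `1`, with the steps lifted by `s`. -/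
def liftPath (s : G → F) (r : ℕ → G) (a : ℕ) : F :=
  ((List.range a).map fun i => s ((r i)⁻¹ * r (i + 1))).prod

variable {s : G → F} {r : ℕ → G} {a : ℕ}

theorem liftPath_zero : liftPath s r 0 = 1 := rfl

theorem liftPath_succ : liftPath s r (a + 1) = liftPath s r a * s ((r a)⁻¹ * r (a + 1)) :=
  List.prod_range_succ _ _

theorem map_liftPath {φ : F →* G} (hs : ∀ x, φ (s x) = x) (hr : r 0 = 1) :
    φ (liftPath s r a) = r a := by
  induction a with
  | zero => rw [liftPath_zero, map_one, hr]
  | succ a ih => rw [liftPath_succ, map_mul, ih, hs, mul_inv_cancel_left]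

theorem liftPath_eq_one (hs : s 1 = 1) (hr : ∀ i ≤ a, r i = 1) : liftPath s r a = 1 := by
  induction a with
  | zero => rfl
  | succ a ih =>
    rw [liftPath_succ, ih fun i hi => hr i (by omega), hr a (by omega), hr (a + 1) le_rfl]
    simpa using hs

end LiftPath

section Halving

variable {G : Type*} [Group G] {S : Finset G} {hS : Subgroup.closure (S : Set G) = ⊤}
  {X : Type*} [DecidableEq X] {φ : FreeGroup X →* G} {w : List (X × Bool)} {k L L' : ℕ} {δ : ℝ}
  {s : G → FreeGroup X} {f : ℕ → ℕ → G}

theorem norm_mk_take_inv_mul_mk_take_le (hk : k ≠ 0) (a : ℕ) :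
    ((FreeGroup.mk (w.take (a * w.length / k)))⁻¹ *
      FreeGroup.mk (w.take ((a + 1) * w.length / k))).norm ≤ w.length / k + 1 := by
  have hle : a * w.length / k ≤ (a + 1) * w.length / k :=
    Nat.div_le_div_right (Nat.mul_le_mul_right _ a.le_succ)
  have hsucc : (a + 1) * w.length / k ≤ a * w.length / k + w.length / k + 1 := by
    rw [Nat.succ_mul, Nat.add_div (Nat.pos_of_ne_zero hk)]
    split_ifs <;> omega
  rw [mk_take_inv_mul_mk_take hle]
  refine FreeGroup.norm_mk_le.trans ?_
  rw [List.length_drop, List.length_take]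
  omega

theorem IsGridFilling.exists_rows
    (hf : IsGridFilling (M := WordMetric S hS) k δ
      (fun a => prefixPoint hS φ w (a * w.length / k)) (WordMetric.basepoint S hS) f)
    (hk : k ≠ 0) (hs : ∀ x, φ (s x) = x) (hs₁ : s 1 = 1)
    (hsL : ∀ x, (wordLength S x : ℝ) ≤ δ → (s x).norm ≤ L) (hL : w.length / k + 1 ≤ L) :
    ∃ p : ℕ → ℕ → FreeGroup X, (∀ b, p 0 b = 1) ∧ p k 0 = FreeGroup.mk w ∧ p k k = 1 ∧
      (∀ a ≤ k, ∀ b ≤ k, φ (p a b) = f a b) ∧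
      ∀ a < k, ∀ b ≤ k, ((p a b)⁻¹ * p (a + 1) b).norm ≤ L := by
  refine ⟨fun a b => if b = 0 then FreeGroup.mk (w.take (a * w.length / k)) else
    liftPath s (fun i => f i b) a, fun b => ?_, ?_, ?_, fun a ha b hb => ?_, fun a ha b hb => ?_⟩
  · simp [← FreeGroup.one_eq_mk, liftPath_zero]
  · simp [Nat.mul_div_cancel_left _ (Nat.pos_of_ne_zero hk)]
  · exact (if_neg hk).trans (liftPath_eq_one hs₁ hf.top)
  · dsimp only
    split_ifs with hb₀
    · rw [hb₀]
      exact (hf.bottom a ha).symm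
    · exact map_liftPath hs (hf.left b hb)
  · dsimp only
    split_ifs with hb₀
    · exact (norm_mk_take_inv_mul_mk_take_le hk a).trans hL
    · rw [liftPath_succ, inv_mul_cancel_left]
      exact hsL _ (hf.dist_horizontal_le a ha b hb)

theorem IsGridFilling.isConjProd
    (hf : IsGridFilling (M := WordMetric S hS) k δ
      (fun a => prefixPoint hS φ w (a * w.length / k)) (WordMetric.basepoint S hS) f)
    (hk : k ≠ 0) (hs : ∀ x, φ (s x) = x) (hs₁ : s 1 = 1)
    (hsL : ∀ x, (wordLength S x : ℝ) ≤ δ → (s x).norm ≤ L) (hL : w.length / k + 1 ≤ L)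
    (hL' : 4 * L ≤ L') :
    IsConjProd {v | φ v = 1 ∧ v.norm ≤ L'} (k * L) (k * k) (FreeGroup.mk w) := by
  obtain ⟨p, hp₀, hpw, hpk, hφp, hpL⟩ := hf.exists_rows hk hs hs₁ hsL hL
  let v (a b : ℕ) : FreeGroup X := s ((f a b)⁻¹ * f a (b + 1))
  have hvL {a b : ℕ} (ha : a ≤ k) (hb : b < k) : (v a b).norm ≤ L :=
    hsL _ (hf.dist_vertical_le a ha b hb)
  have hside {x y : G} (hx : x = 1) (hy : y = 1) : s (x⁻¹ * y) = 1 := by simpa [hx, hy] using hs₁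
  have hleft (b : ℕ) (hb : b < k) : v 0 b = 1 := hside (hf.left b hb.le) (hf.left (b + 1) hb)
  have hright (b : ℕ) (hb : b < k) : v k b = 1 := hside (hf.right b hb.le) (hf.right (b + 1) hb)
  have hmesh (a : ℕ) (ha : a < k) (b : ℕ) (hb : b < k) :
      (p a b)⁻¹ * p (a + 1) b * v (a + 1) b * ((p a (b + 1))⁻¹ * p (a + 1) (b + 1))⁻¹ *
        (v a b)⁻¹ ∈ {v | φ v = 1 ∧ v.norm ≤ L'} := by
    constructor
    · simp only [map_mul, map_inv, hφp a ha.le b hb.le, hφp (a + 1) ha b hb.le, v, hs,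
        hφp a ha.le (b + 1) hb, hφp (a + 1) ha (b + 1) hb]
      group
    · refine (norm_mul_mul_inv_mul_inv_le _ _ _ _).trans ?_
      have h₁ := hpL a ha b hb.le
      have h₂ := hpL a ha (b + 1) hb
      have h₃ := hvL (show a + 1 ≤ k from ha) hb
      have h₄ := hvL ha.le hb
      omega
  have hp (a : ℕ) (ha : a < k) (b : ℕ) (hb : b < k) : (p a b).norm ≤ k * L :=
    (norm_le_mul_of_norm_inv_mul_le (hp₀ b) (fun a ha => hpL a ha b hb.le) ha.le).trans
      (Nat.mul_le_mul_right L ha.le)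
  simpa [hpw, hpk] using
    isConjProd_lattice (fun b hb => by simp [hp₀, hleft b hb]) hright hp hmesh

theorem exists_section_norm_le (hS : Subgroup.closure (S : Set G) = ⊤)
    (hφ : Function.Surjective φ) :
    ∃ (s : G → FreeGroup X) (C : ℕ), (∀ x, φ (s x) = x) ∧
      ∀ x, (s x).norm ≤ C * wordLength S x := by
  let C := S.sup fun x => (Function.surjInv hφ x).norm
  have hgen (x : G) (hx : x ∈ S ∨ x⁻¹ ∈ S) : ∃ t, φ t = x ∧ t.norm ≤ C := by
    rcases hx with hx | hx
    · exact ⟨_, Function.surjInv_eq hφ x,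
        Finset.le_sup (f := fun x => (Function.surjInv hφ x).norm) hx⟩
    · refine ⟨(Function.surjInv hφ x⁻¹)⁻¹, by rw [map_inv, Function.surjInv_eq hφ, inv_inv], ?_⟩
      rw [FreeGroup.norm_inv_eq]
      exact Finset.le_sup (f := fun x => (Function.surjInv hφ x).norm) hx
  have hprod (l : List G) (hl : ∀ x ∈ l, x ∈ S ∨ x⁻¹ ∈ S) :
      ∃ u, φ u = l.prod ∧ u.norm ≤ C * l.length := by
    induction l with
    | nil => exact ⟨1, by simp, by simp⟩
    | cons x l ih =>
      rw [List.forall_mem_cons] at hl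
      obtain ⟨t, ht, htn⟩ := hgen x hl.1
      obtain ⟨u, hu, hun⟩ := ih hl.2
      refine ⟨t * u, by rw [map_mul, ht, hu, List.prod_cons], ?_⟩
      rw [List.length_cons, Nat.mul_succ, add_comm]
      exact (FreeGroup.norm_mul_le _ _).trans (Nat.add_le_add htn hun)
  choose word hword hwordprod hlength using exists_word_of_closure hS
  choose s hs hsC using fun x => hprod (word x) (hword x)
  exact ⟨s, C, fun x => (hs x).trans (hwordprod x), fun x => hlength x ▸ hsC x⟩

theorem exists_isConjProd_half [Finite X] {ω : Ultrafilter ℕ} (hω : (ω : Filter ℕ) ≤ cofinite)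
    (hcones : ∀ d, SimplyConnectedSpace
      (AsymptoticCone (WordMetric S hS) ω d fun _ => WordMetric.basepoint S hS))
    (hφ : Function.Surjective φ) :
    ∃ m N : ℕ, ∀ u, φ u = 1 → N ≤ u.norm →
      ∃ A ≤ m, IsConjProd {v | φ v = 1 ∧ v.norm ≤ u.norm / 2} (m * u.norm) A u := by
  obtain ⟨s, C, hs, hsC⟩ := exists_section_norm_le hS hφ
  have hs₁ : s 1 = 1 := FreeGroup.norm_eq_zero.1 (by simpa [wordLength_one] using hsC 1)
  obtain ⟨m, N, hgrid⟩ := exists_forall_hasGridFilling hω hcones φ 16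
    (ε := 1 / (16 * (C + 1))) (by positivity)
  refine ⟨m * m, max N 16, fun u hu hN => ?_⟩
  obtain ⟨k, hk, hkm, g, hg⟩ := hgrid u.toWord (le_of_max_le_left hN) (by rwa [FreeGroup.mk_toWord])
  have hlen : u.toWord.length = u.norm := rfl
  have hN₁₆ : 16 ≤ u.norm := le_of_max_le_right hN
  have hsL (x : G) (hx : (wordLength S x : ℝ) ≤ 1 / (16 * (C + 1)) * u.toWord.length) :
      (s x).norm ≤ u.norm / 16 + 1 := by
    rw [one_div_mul_eq_div, le_div_iff₀ (by positivity), hlen] at hx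
    have hx' : wordLength S x * (16 * (C + 1)) ≤ u.norm := by exact_mod_cast hx
    have := hsC x
    have : 16 * (s x).norm ≤ u.norm := by nlinarith
    omega
  have hL : u.toWord.length / k + 1 ≤ u.norm / 16 + 1 :=
    Nat.add_le_add_right (Nat.div_le_div_left hk (by norm_num)) 1
  have H := hg.isConjProd (L' := u.norm / 2) (by omega) hs hs₁ hsL hL (by omega)
  rw [FreeGroup.mk_toWord] at H
  exact ⟨k * k, Nat.mul_le_mul hkm hkm, H.mono (Nat.mul_le_mul (hkm.trans (Nat.le_mul_self m))
    (by omega))⟩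

end Halving

section Filling

variable {X : Type*} [DecidableEq X] {K : FreeGroup X → Prop} {R : Set (FreeGroup X)} {m N c : ℕ}

theorem finite_norm_le [Finite X] (N : ℕ) : {u : FreeGroup X | u.norm ≤ N}.Finite :=
  (List.finite_length_le (X × Bool) N).preimage FreeGroup.toWord_injective.injOn

/-- The degree `m` suffices because halving `n` divides `n ^ m` by `2 ^ m ≥ m`; the conjugators have
length `O(n)` because the lengths `n`, `n / 2`, `n / 4`, … form a geometric series. -/
theorem exists_isConjProd_of_half
    (hhalf : ∀ u, K u → N ≤ u.norm →
      ∃ A ≤ m, IsConjProd {v | K v ∧ v.norm ≤ u.norm / 2} (m * u.norm) A u)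
    (hbase : ∀ u, K u → u.norm < N → ∃ A ≤ c, IsConjProd R c A u) (u : FreeGroup X) (hu : K u) :
    ∃ A ≤ c * u.norm ^ m, IsConjProd R (2 * m * u.norm + c) A u := by
  induction hn : u.norm using Nat.strong_induction_on generalizing u with
  | _ n ih =>
    rcases Nat.eq_zero_or_pos n with rfl | hpos
    · rw [FreeGroup.norm_eq_zero] at hn
      exact ⟨0, Nat.zero_le _, hn ▸ .one⟩
    rcases lt_or_ge n N with hnN | hnN
    · obtain ⟨A, hA, H⟩ := hbase u hu (hn ▸ hnN)
      exact ⟨A, hA.trans (Nat.le_mul_of_pos_right _ (pow_pos hpos m)), H.mono (Nat.le_add_left _ _)⟩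
    · obtain ⟨A, hA, H⟩ := hhalf u hu (hn ▸ hnN)
      rw [hn] at H
      have hhalves (v : FreeGroup X) (hv : K v ∧ v.norm ≤ n / 2) :
          ∃ A ≤ c * (n / 2) ^ m, IsConjProd R (2 * m * (n / 2) + c) A v := by
        obtain ⟨A, hA, H⟩ := ih v.norm (by omega) v hv.1 rfl
        have hv₂ := hv.2
        exact ⟨A, hA.trans (by gcongr), H.mono (by gcongr)⟩
      obtain ⟨B, hB, H'⟩ := H.subst hhalves
      have hdiv : n / 2 * 2 ≤ n := Nat.div_mul_le_self n 2
      refine ⟨B, hB.trans ?_, H'.mono (by nlinarith)⟩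
      calc A * (c * (n / 2) ^ m)
          ≤ 2 ^ m * (c * (n / 2) ^ m) := Nat.mul_le_mul_right _ (hA.trans Nat.lt_two_pow_self.le)
        _ = c * (n / 2 * 2) ^ m := by rw [mul_pow]; ring
        _ ≤ c * n ^ m := by gcongr

theorem exists_forall_norm_lt_isConjProd [Finite X] (N : ℕ) :
    ∃ c, ∀ u ∈ Subgroup.normalClosure R, u.norm < N → ∃ A ≤ c, IsConjProd R c A u := by
  have hex (u : FreeGroup X) :
      ∃ c, u ∈ Subgroup.normalClosure R → ∃ A ≤ c, IsConjProd R c A u := by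
    by_cases hu : u ∈ Subgroup.normalClosure R
    · obtain ⟨h, A, H⟩ := IsConjProd.exists_of_mem_normalClosure hu
      exact ⟨max h A, fun _ => ⟨A, le_max_right _ _, H.mono (le_max_left _ _)⟩⟩
    · exact ⟨0, fun h => absurd h hu⟩
  choose c hc using hex
  obtain ⟨b, hb⟩ := ((finite_norm_le (X := X) N).image c).bddAbove
  refine ⟨b, fun u hu huN => ?_⟩
  have hcb : c u ≤ b := hb ⟨u, huN.le, rfl⟩
  obtain ⟨A, hA, H⟩ := hc u hu
  exact ⟨A, hA.trans hcb, H.mono hcb⟩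

end Filling

/-- Every word `w` that is trivial in the group of the presentation bounds a diagram of area at most
`area |w|` and diameter at most `diam |w|`, simultaneously. -/
def HasDiagramBounds {X : Type*} (R : Set (FreeGroup X)) (area diam : ℕ → ℕ) : Prop :=
  ∀ w, FreeGroup.mk w ∈ Subgroup.normalClosure R →
    ∃ Δ : VanKampenDiagram R w, Δ.area ≤ area w.length ∧ Δ.diameter ≤ diam w.length

namespace HasDiagramBounds

variable {X : Type*} {R : Set (FreeGroup X)} {area diam : ℕ → ℕ}

theorem dehnFunction_le (H : HasDiagramBounds R area diam) (harea : Monotone area) (n : ℕ) :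
    dehnFunction R n ≤ area n := by
  refine iSup_le fun w => iSup_le fun hw => iSup_le fun hwR => ?_
  obtain ⟨Δ, hΔ, -⟩ := H w hwR
  exact iInf_le_of_le Δ (Nat.cast_le.2 (hΔ.trans (harea hw)))

theorem diameterFunction_le (H : HasDiagramBounds R area diam) (hdiam : Monotone diam) (n : ℕ) :
    diameterFunction R n ≤ diam n := by
  refine iSup_le fun w => iSup_le fun hw => iSup_le fun hwR => ?_
  obtain ⟨Δ, -, hΔ⟩ := H w hwR
  exact iInf_le_of_le Δ (hΔ.trans (Nat.cast_le.2 (hdiam hw)))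

end HasDiagramBounds

section Presentation

variable {G : Type*} [Group G] {S : Finset G} {hS : Subgroup.closure (S : Set G) = ⊤}
  {ω : Ultrafilter ℕ}

theorem isFinitelyPresented_of_cones (hω : (ω : Filter ℕ) ≤ cofinite)
    (hcones : ∀ d, SimplyConnectedSpace
      (AsymptoticCone (WordMetric S hS) ω d fun _ => WordMetric.basepoint S hS)) :
    Group.IsFinitelyPresented G := by
  let φ : FreeGroup (Fin S.card) →* G := FreeGroup.lift fun i => (S.equivFin.symm i : G)
  have hφ : Function.Surjective φ := by
    rw [← MonoidHom.range_eq_top, FreeGroup.range_lift_eq_closure, ← hS]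
    congr 1
    exact (S.equivFin.symm.surjective.range_comp Subtype.val).trans Subtype.range_coe
  obtain ⟨m, N, hhalf⟩ := exists_isConjProd_half hω hcones hφ
  refine ⟨S.card, φ, hφ, {u | φ u = 1 ∧ u.norm ≤ N},
    (finite_norm_le N).subset fun u hu => hu.2, le_antisymm ?_ fun u hu => ?_⟩
  · exact Subgroup.normalClosure_le_normal fun u hu => hu.1
  · obtain ⟨A, -, H⟩ := exists_isConjProd_of_half (c := 1) (R := {u | φ u = 1 ∧ u.norm ≤ N}) hhalf
      (fun u hu hun => ⟨1, le_rfl, .of_mem (Or.inl ⟨hu, hun.le⟩)⟩) u hu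
    exact H.mem_normalClosure

variable {X : Type*} [Finite X] {R : Set (FreeGroup X)}

theorem exists_isConjProd_of_cones [DecidableEq X] (hω : (ω : Filter ℕ) ≤ cofinite)
    (hcones : ∀ d, SimplyConnectedSpace
      (AsymptoticCone (WordMetric S hS) ω d fun _ => WordMetric.basepoint S hS))
    (e : PresentedGroup R ≃* G) :
    ∃ m c : ℕ, ∀ u ∈ Subgroup.normalClosure R,
      ∃ A ≤ c * u.norm ^ m, IsConjProd R (2 * m * u.norm + c) A u := by
  let φ : FreeGroup X →* G := e.toMonoidHom.comp (PresentedGroup.mk R)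
  have hφ : Function.Surjective φ := e.surjective.comp (PresentedGroup.mk_surjective R)
  have hker (u : FreeGroup X) : φ u = 1 ↔ u ∈ Subgroup.normalClosure R :=
    (map_eq_one_iff e e.injective).trans PresentedGroup.mk_eq_one_iff
  obtain ⟨m, N, hhalf⟩ := exists_isConjProd_half hω hcones hφ
  simp only [hker] at hhalf
  obtain ⟨c, hc⟩ := exists_forall_norm_lt_isConjProd (R := R) N
  exact ⟨m, c, exists_isConjProd_of_half hhalf hc⟩

theorem exists_hasDiagramBounds_of_cones (hω : (ω : Filter ℕ) ≤ cofinite)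
    (hcones : ∀ d, SimplyConnectedSpace
      (AsymptoticCone (WordMetric S hS) ω d fun _ => WordMetric.basepoint S hS))
    (hR : R.Finite) (e : PresentedGroup R ≃* G) :
    ∃ m c C : ℕ, HasDiagramBounds R (fun n => c * n ^ m) (fun n => C * n + C) := by
  classical
  obtain ⟨m, c, hfill⟩ := exists_isConjProd_of_cones hω hcones e
  obtain ⟨M, hM⟩ := (hR.image FreeGroup.norm).bddAbove
  refine ⟨m, c, 4 * m + 2 * c + 2 * M + 2, fun w hw => ?_⟩
  have hn : (FreeGroup.mk w).norm ≤ w.length := FreeGroup.norm_mk_le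
  obtain ⟨A, hA, H⟩ := hfill _ hw
  obtain ⟨Δ, harea, hdiam⟩ := H.exists_diagram fun r hr => hM ⟨r, hr, rfl⟩
  have hpow : c * (FreeGroup.mk w).norm ^ m ≤ c * w.length ^ m := by gcongr
  refine ⟨Δ, (harea.trans hA).trans hpow, hdiam.trans (Nat.cast_le.2 ?_)⟩
  calc 2 * max (2 * m * (FreeGroup.mk w).norm + c + M) w.length
      ≤ 2 * (2 * m * w.length + c + M + w.length) := by
        gcongr
        exact max_le (by nlinarith) (by lia)
    _ ≤ (4 * m + 2 * c + 2 * M + 2) * w.length + (4 * m + 2 * c + 2 * M + 2) := by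
        nlinarith [Nat.zero_le (c * w.length), Nat.zero_le (M * w.length)]

end Presentation

theorem mainTheorem3_general {G : Type*} [Group G] (S : Finset G)
    (hS : Subgroup.closure (S : Set G) = ⊤) (ω : Ultrafilter ℕ) (hω : (ω : Filter ℕ) ≤ cofinite)
    (hcones : ∀ d : ScalingConstants, SimplyConnectedSpace
      (AsymptoticCone (WordMetric S hS) ω d fun _ => WordMetric.basepoint S hS)) :
    Group.IsFinitelyPresented G ∧
    ∀ (X : Type*) [Finite X] (R : Set (FreeGroup X)), R.Finite →
      Nonempty (PresentedGroup R ≃* G) →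
      (∃ p : Polynomial ℕ, IsIsoperimetricFunction R fun n => p.eval n) ∧
      IsIsodiametricFunction R fun n => n := by
  refine ⟨isFinitelyPresented_of_cones hω hcones, fun X _ R hR ⟨e⟩ => ?_⟩
  obtain ⟨m, c, C, H⟩ := exists_hasDiagramBounds_of_cones hω hcones hR e
  refine ⟨⟨Polynomial.C c * Polynomial.X ^ m, 1, fun n => ?_⟩, C, fun n => ?_⟩
  · have harea : Monotone fun n => c * n ^ m := fun a b hab => by dsimp only; gcongr
    refine (H.dehnFunction_le harea n).trans (Nat.cast_le.2 ?_)
    simp only [Polynomial.eval_mul, Polynomial.eval_C, Polynomial.eval_pow, Polynomial.eval_X,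
      one_mul]
    lia
  · have hdiam : Monotone fun n => C * n + C := fun a b hab => by dsimp only; gcongr
    refine (H.diameterFunction_le hdiam n).trans (Nat.cast_le.2 ?_)
    lia

theorem mainTheorem3 {G : Type*} [Group G] (S : Finset G)
    (hS : Subgroup.closure (S : Set G) = ⊤) (hcones : AllConesSimplyConnected S hS) :
    Group.IsFinitelyPresented G ∧
    ∀ (X : Type*) [Finite X] (R : Set (FreeGroup X)), R.Finite →
      Nonempty (PresentedGroup R ≃* G) →
      (∃ p : Polynomial ℕ, IsIsoperimetricFunction R fun n => p.eval n) ∧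
      IsIsodiametricFunction R fun n => n :=
  mainTheorem3_general S hS (hyperfilter ℕ) hyperfilter_le_cofinite
    (hcones _ hyperfilter_le_cofinite)
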